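/- **Theorem (Global convergence).** Let $C\subset\mathbb R^n$ be nonempty, open and convex, let $f,g,\phi:\mathbb R^n\to(-\infty,+\infty]$, and put $\Psi=f+g$. Here $\delta_{\operatorname{cl}C}$ is the indicator function of $\operatorname{cl}C$, $\partial$ is the limiting subdifferential, and $\operatorname{dom}\partial F=\{x:\partial F(x)\ne\emptyset\}$. Assume: 1. $\phi$ is proper, lower semicontinuous and convex, with $\operatorname{dom}\phi\subset\operatorname{cl}C=\operatorname{cl}\operatorname{dom}\phi$, $\operatorname{dom}\partial\phi=C=\operatorname{int}\operatorname{dom}\phi$; $\phi$ is $\mathcal C^2$ on $C$ and $\sigma$-strongly convex on $C$ for some $\sigma>0$. 2. $f$ is proper and lower semicontinuous with $\operatorname{dom}\phi\subset\operatorname{dom}f$, and $\mathcal C^1$ on $C$; moreover $f$ is finite and differentiable on $\mathbb R^n$ and $\nabla f$ is Lipschitz continuous on every compact subset of $\mathbb R^n$. 3. $g$ is proper, lower semicontinuous and convex with $C\subset\operatorname{dom}g$. 4. $\inf_{\operatorname{cl}C}\Psi>-\infty$; all sets $\{x\in\mathbb R^n:\Psi(x)\le r\}$, $r\in\mathbb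 R$, are bounded; for all $x\in C$, $\lambda>0$, $\bigl(\lambda g(u)+\tfrac12\langle\nabla^2\phi(x)(u-x),u-x\rangle\bigr)/\|u\|\to\infty$ as $\|u\|\to\infty$. 5. For all $x\in C$, $\lambda>0$, the set $\tilde{\mathcal T}_\lambda(x)=\operatorname{argmin}_{u\in\operatorname{cl}C}\{\langle\nabla f(x),u-x\rangle+g(u)+\tfrac1{2\lambda}\langle\nabla^2\phi(x)(u-x),u-x\rangle\}$ is contained in $C$. 6. $\Psi$ is a KL function: for every $\bar x\in\operatorname{dom}\partial\Psi$ there are a neighborhood $U$ of $\bar x$, $v\in(0,+\infty]$ and $\psi\in\Xi_v$ with $$\psi'(\Psi(x)-\Psi(\bar x))\operatorname{dist}(0,\partial\Psi(x))\ge1\quad\text{for all }x\in U\text{ with }\Psi(\bar x)<\Psi(x)<\Psi(\bar x)+v,\tag{KL}$$ where $\Xi_v$ is the set of continuous concave $\psi:[0,v)\to\mathbb R_+$ with $\psi(0)=0$ that are $\mathcal C^1$ with $\psi'>0$ on $(0,v)$. Let $\lambda>0$, $0<c_1<c_2<1$, and let $(x^k)_{k\ge0}\subset C$ be generated by ABPG-VMAW: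 for every $k\ge 0$, $y^k\in\tilde{\mathcal T}_\lambda(x^k)$, $d^k=y^k-x^k$, $\xi^k\in\partial g(x^k)$, the step size $t_k>0$ satisfies $$\Psi(x^k+t_kd^k)+\delta_{\operatorname{cl}C}(x^k+t_kd^k)<\Psi(x^k)+c_1t_k\Bigl(\langle\nabla f(x^k),d^k\rangle+g(x^k+d^k)-g(x^k)+\tfrac1{2\lambda}\langle\nabla^2\phi(x^k)d^k,d^k\rangle\Bigr),$$ $$\langle\nabla f(x^k+t_kd^k)+\xi^k,d^k\rangle>c_2\langle\nabla f(x^k)+\xi^k,d^k\rangle,$$ and $x^{k+1}=y^k$ if $\Psi(y^k)<\Psi(x^k+t_kd^k)$, $x^{k+1}=x^k+t_kd^k$ otherwise. Assume that $(t_k)$ is bounded above and that the Hessians $\nabla^2\phi(x^k)$, $k\ge 0$, are bounded (this is automatic if $C=\mathbb R^n$, or if the iterates stay in a compact subset of $C$). Then there are $\rho_1,\rho_2>0$ such that, for all $k$, $\Psi(x^{k+1})+\rho_1\|x^{k+1}-x^k\|^2\le\Psi(x^k)$ and some $w^k\in\nabla f(y^k)+\partial(g+\delta_{\operatorname{cl}C})(y^k)$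 satisfies $\|w^k\|\le\rho_2\|x^{k+1}-x^k\|$, and such that the following holds for every accumulation point $\bar x$ of $(x^k)$. There are $\rho>0$, $v\in(0,+\infty]$ and $\psi\in\Xi_v$ for which (KL) holds with $U=B(\bar x,\rho)$, the closed ball; and for any such $\rho,v,\psi$, with $\chi_k=\frac{\rho_2}{\rho_1}[\psi(\Psi(x^k)-\Psi(\bar x))-\psi(\Psi(x^{k+1})-\Psi(\bar x))]$: (i) for all sufficiently large $k_0$ and all $k\ge1$, if $x^{k_0+k},y^{k_0+k-1}\in B(\bar x,\rho)$, then $2\|x^{k_0+k+1}-x^{k_0+k}\|\le\|x^{k_0+k}-x^{k_0+k-1}\|+\chi_{k_0+k}$; (ii) there is $\bar k_0$ such that, for all $k\ge1$, $x^{\bar k_0+k},y^{\bar k_0+k-1}\in B(\bar x,\rho)$ and $$\sum_{i=\bar k_0+1}^{\bar k_0+k}\|x^{i+1}-x^i\|+\|x^{\bar k_0+k+1}-x^{\bar k_0+k}\|\le\|x^{\bar k_0+1}-x^{\bar k_0}\|+\sum_{i=\bar k_0+1}^{\bar k_0+k}\chi_i .$$ Moreover: (iii) $(x^k)$ converges to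 a stationary point of $\Psi$, that is, to some $x^*$ with $0\in\nabla f(x^*)+\partial(g+\delta_{\operatorname{cl}C})(x^*)$, and $\sum_{k=0}^\infty\|x^{k+1}-x^k\|<\infty$. -/

import Mathlib

open Filter Topology Set

noncomputable section

namespace ABPG

/-- The Euclidean space of dimension `n`. -/
abbrev Vec (n : ℕ) := EuclideanSpace ℝ (Fin n)

variable {n : ℕ}

/-! ### Extended-real-valued functions -/

/-- Effective domain. -/
def dom (F : Vec n → EReal) : Set (Vec n) := {x | F x < ⊤}

/-- Proper: never `-∞`, and not identically `+∞`. -/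
def IsProper (F : Vec n → EReal) : Prop := (∀ x, F x ≠ ⊥) ∧ (dom F).Nonempty

/-- Convexity of an extended-real-valued function: the epigraph is convex. -/
def IsConvex (F : Vec n → EReal) : Prop :=
  Convex ℝ {p : Vec n × ℝ | F p.1 ≤ (p.2 : EReal)}

open Classical in
/-- Indicator function `δ_S`. -/
def indicatorFn (S : Set (Vec n)) (x : Vec n) : EReal := if x ∈ S then 0 else ⊤

/-- The real-valued function that agrees with `F` wherever `F` is finite. It is only used on sets
where `F` is finite. -/
def realPart (F : Vec n → EReal) (x : Vec n) : ℝ := (F x).toReal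

/-- Gradient `∇F`. -/
def grad (F : Vec n → EReal) (x : Vec n) : Vec n := gradient (realPart F) x

/-- Hessian `∇²F(x)`, as a linear operator: the derivative of the gradient. -/
def hess (F : Vec n → EReal) (x : Vec n) : Vec n →L[ℝ] Vec n := fderiv ℝ (grad F) x

/-- Regular subdifferential. -/
def regularSubdiff (F : Vec n → EReal) (x : Vec n) : Set (Vec n) :=
  {ξ | x ∈ dom F ∧
    0 ≤ liminf (fun y => (F y - F x - ((inner ℝ ξ (y - x) : ℝ) : EReal)) / ((‖x - y‖ : ℝ) : EReal))
      (𝓝[≠] x)}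

/-- Limiting subdifferential. -/
def limitingSubdiff (F : Vec n → EReal) (x : Vec n) : Set (Vec n) :=
  {ξ | x ∈ dom F ∧ ∃ (xs ξs : ℕ → Vec n),
    Tendsto xs atTop (𝓝 x) ∧ Tendsto (fun k => F (xs k)) atTop (𝓝 (F x)) ∧
    Tendsto ξs atTop (𝓝 ξ) ∧ ∀ k, ξs k ∈ regularSubdiff F (xs k)}

/-- `dom ∂F`. -/
def domSubdiff (F : Vec n → EReal) : Set (Vec n) := {x | (limitingSubdiff F x).Nonempty}

/-! ### The Kurdyka–Łojasiewicz property -/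

/-- The class `Ξ_v` of desingularizing functions on `[0, v)`, where `v` may be `+∞`. -/
structure IsDesingularizing (v : EReal) (ψ : ℝ → ℝ) : Prop where
  continuousOn : ContinuousOn ψ {s : ℝ | 0 ≤ s ∧ (s : EReal) < v}
  concaveOn : ConcaveOn ℝ {s : ℝ | 0 ≤ s ∧ (s : EReal) < v} ψ
  nonneg : ∀ s : ℝ, 0 ≤ s → (s : EReal) < v → 0 ≤ ψ s
  zero : ψ 0 = 0
  contDiffOn : ContDiffOn ℝ 1 ψ {s : ℝ | 0 < s ∧ (s : EReal) < v}
  deriv_pos : ∀ s : ℝ, 0 < s → (s : EReal) < v → 0 < deriv ψ s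

/-- The KL inequality `ψ'(F(x) - F(x̄)) dist(0, ∂F(x)) ≥ 1` holds for all
`x ∈ U ∩ [F(x̄) < F < F(x̄) + v]`, where `ψ ∈ Ξ_v` and `v ∈ (0, +∞]`. The distance to the empty
set is `+∞`. -/
def KLInequalityOn (F : Vec n → EReal) (xbar : Vec n) (U : Set (Vec n)) (v : EReal)
    (ψ : ℝ → ℝ) : Prop :=
  0 < v ∧ IsDesingularizing v ψ ∧
    ∀ x ∈ U, F xbar < F x → F x < F xbar + v →
      1 ≤ ENNReal.ofReal (deriv ψ (F x - F xbar).toReal) *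
        Metric.infEDist (0 : Vec n) (limitingSubdiff F x)

/-- `F` is a KL function: the KL property holds at each point of `dom ∂F`. -/
def IsKLFunction (F : Vec n → EReal) : Prop :=
  ∀ xbar ∈ domSubdiff F, ∃ (v : EReal) (U : Set (Vec n)) (ψ : ℝ → ℝ),
    U ∈ 𝓝 xbar ∧ KLInequalityOn F xbar U v ψ

/-! ### The problem and its standing assumptions -/

/-- `φ` is a kernel generating distance associated with `C`. -/
structure IsKernelGeneratingDistance (C : Set (Vec n)) (φ : Vec n → EReal) : Prop where
  proper : IsProper φ
  lsc : LowerSemicontinuous φ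
  convex : IsConvex φ
  dom_subset : dom φ ⊆ closure C
  domSubdiff_eq : domSubdiff φ = C
  interior_dom : interior (dom φ) = C
  contDiffOn : ContDiffOn ℝ 1 (realPart φ) C

/-- The objective `Ψ = f + g`. -/
def objective (f g : Vec n → EReal) (x : Vec n) : EReal := f x + g x

/-- The approximate Bregman distance `½⟨∇²φ(x)(u - x), u - x⟩`. -/
def approxBregman (φ : Vec n → EReal) (u x : Vec n) : ℝ :=
  (1 / 2) * inner ℝ (hess φ x (u - x)) (u - x)

/-- Standing assumptions on `C`, `φ`, `f` and `g`. -/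
structure BasicAssumptions (C : Set (Vec n)) (f g φ : Vec n → EReal) : Prop where
  C_nonempty : C.Nonempty
  C_open : IsOpen C
  C_convex : Convex ℝ C
  kernel : IsKernelGeneratingDistance C φ
  closure_eq : closure C = closure (dom φ)
  kernel_contDiffOn : ContDiffOn ℝ 2 (realPart φ) C
  f_proper : IsProper f
  f_lsc : LowerSemicontinuous f
  f_dom : dom φ ⊆ dom f
  f_contDiffOn : ContDiffOn ℝ 1 (realPart f) C
  g_proper : IsProper g
  g_lsc : LowerSemicontinuous g
  g_convex : IsConvex g
  g_dom : C ⊆ dom g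
  bounded_below : ⊥ < ⨅ x ∈ closure C, objective f g x
  supercoercive : ∀ x ∈ C, ∀ lam : ℝ, 0 < lam →
    Tendsto (fun u => ((lam : EReal) * g u + (approxBregman φ u x : EReal)) / ((‖u‖ : ℝ) : EReal))
      (Bornology.cobounded (Vec n)) (𝓝 ⊤)

/-- Objective function of the subproblem at `x`. -/
def subObjective (f g φ : Vec n → EReal) (lam : ℝ) (x u : Vec n) : EReal :=
  ((inner ℝ (grad f x) (u - x) : ℝ) : EReal) + g u + ((1 / lam * approxBregman φ u x : ℝ) : EReal)

/-- The approximate Bregman proximal gradient mapping: the set of minimizers over `cl C`. -/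
def proxMap (C : Set (Vec n)) (f g φ : Vec n → EReal) (lam : ℝ) (x : Vec n) : Set (Vec n) :=
  {u | u ∈ closure C ∧ IsMinOn (subObjective f g φ lam x) (closure C) u}

/-- Feasibility of the subproblem's solutions. -/
def Feasible (C : Set (Vec n)) (f g φ : Vec n → EReal) : Prop :=
  ∀ x ∈ C, ∀ lam : ℝ, 0 < lam → proxMap C f g φ lam x ⊆ C

/-- All lower level sets are bounded. -/
def LevelBounded (F : Vec n → EReal) : Prop :=
  ∀ r : ℝ, Bornology.IsBounded {x | F x ≤ (r : EReal)}

/-- `f` is finite and differentiable on the whole space, and `∇f` is Lipschitz continuous on every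
compact set. -/
structure GradLipschitzOnCompacts (f : Vec n → EReal) : Prop where
  finite : ∀ x, f x ≠ ⊥ ∧ f x ≠ ⊤
  differentiable : Differentiable ℝ (realPart f)
  lipschitz : ∀ K : Set (Vec n), IsCompact K → ∃ L : NNReal, LipschitzOnWith L (grad f) K

/-- Stationary points: `0 ∈ ∇f(x) + ∂(g + δ_{cl C})(x)`. -/
def IsStationary (C : Set (Vec n)) (f g : Vec n → EReal) (x : Vec n) : Prop :=
  ∃ η ∈ limitingSubdiff (fun u => g u + indicatorFn (closure C) u) x, grad f x + η = 0

/-! ### The algorithm -/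

/-- The sufficient decrease function `A(t)` at the point `x` with direction `d`. -/
def armijo (C : Set (Vec n)) (f g φ : Vec n → EReal) (lam c₁ : ℝ) (x d : Vec n) (t : ℝ) : EReal :=
  objective f g (x + t • d) + indicatorFn (closure C) (x + t • d) - objective f g x -
    ((c₁ * t : ℝ) : EReal) *
      (((inner ℝ (grad f x) d : ℝ) : EReal) + g (x + d) - g x +
        ((1 / (2 * lam) * inner ℝ (hess φ x d) d : ℝ) : EReal))

/-- The curvature function `W(t)` at the point `x` with direction `d` and `ξ ∈ ∂g(x)`. -/
def wolfe (f : Vec n → EReal) (c₂ : ℝ) (x d ξ : Vec n) (t : ℝ) : ℝ :=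
  inner ℝ (grad f (x + t • d) + ξ) d - c₂ * inner ℝ (grad f x + ξ) d

open Classical in
/-- The sequences `x, y, d, ξ, t` are generated by the algorithm ABPG-VMAW. -/
structure IsGenerated (C : Set (Vec n)) (f g φ : Vec n → EReal) (lam c₁ c₂ : ℝ)
    (x y d ξ : ℕ → Vec n) (t : ℕ → ℝ) : Prop where
  mem : ∀ k, x k ∈ C
  subproblem : ∀ k, y k ∈ proxMap C f g φ lam (x k)
  direction : ∀ k, d k = y k - x k
  subgradient : ∀ k, ξ k ∈ limitingSubdiff g (x k)
  step_pos : ∀ k, 0 < t k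
  step_armijo : ∀ k, armijo C f g φ lam c₁ (x k) (d k) (t k) < 0
  step_wolfe : ∀ k, 0 < wolfe f c₂ (x k) (d k) (ξ k) (t k)
  update : ∀ k, x (k + 1) =
    if objective f g (y k) < objective f g (x k + t k • d k) then y k else x k + t k • d k

/-- `χ_k = (ρ₂ / ρ₁) [ψ(Ψ(x^k) - Ψ(x̄)) - ψ(Ψ(x^{k+1}) - Ψ(x̄))]`. -/
def chi (F : Vec n → EReal) (ψ : ℝ → ℝ) (ρ₁ ρ₂ : ℝ) (xbar : Vec n) (x : ℕ → Vec n) (k : ℕ) : ℝ :=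
  ρ₂ / ρ₁ * (ψ (F (x k) - F xbar).toReal - ψ (F (x (k + 1)) - F xbar).toReal)

end ABPG

end

/-!
Convergence of the line-search variable-metric proximal gradient method follows the
Kurdyka–Łojasiewicz scheme. It rests on three facts about a run of the algorithm, collected in
`ABPG.IsDescentRun`.

*Sufficient decrease.* The optimality condition of the subproblem says that
`η = -(∇f(x) + λ⁻¹ ∇²φ(x) d)` is a convex subgradient of `g + δ_{cl C}` at the trial point `y`
(`le_of_mem_proxMap`). Tested at `x`, it gives
`⟨∇f(x), d⟩ + g(y) - g(x) ≤ -λ⁻¹ ⟨∇²φ(x) d, d⟩`, and the right-hand side is at most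
`-(σ/λ) ‖d‖²` by strong convexity of `φ` (`le_inner_hess_of_strongConvexOn`). All iterates and line
search points lie in one bounded level set, on which `∇f` is Lipschitz, so the Wolfe condition bounds
the step sizes away from zero. Hence `‖d‖` and the step length `‖x⁺ - x‖` are comparable, and the
Armijo condition decreases `Ψ` by a multiple of `‖x⁺ - x‖²`.

*Residual bound.* The vector `∇f(y) + η = ∇f(y) - ∇f(x) - λ⁻¹ ∇²φ(x) d` is bounded by a multiple of
`‖d‖`, hence of `‖x⁺ - x‖`. As `y` lies in the open set `C`, it is also a regular subgradient of
`Ψ` at `y`.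

*Continuity along the run.* The values `Ψ(x^k)` and `Ψ(y^k)` have a common limit, which is the value
of `Ψ` at every cluster point; cluster points are stationary and carry the limiting subgradient `0`
of `Ψ` (`IsDescentRun.of_mapClusterPt`), so that the KL property is available there.

The KL inequality is applied at the trial point `y^{k-1}`, not at `x^k`. This suffices since
`Ψ(x^k) ≤ Ψ(y^{k-1})` and the derivative of the concave function `ψ` is decreasing
(`IsDesingularizing.two_mul_le`). The resulting recursion traps the iterates near a cluster point
(`exists_stays_in_closedBall`), which yields finite length and convergence.
-/

namespace ABPG

variable {n : ℕ}

/-! ### Subgradients of extended-real-valued functions -/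

/-- The `ε`-form of the definition of a regular subgradient, free of quotients in `EReal`. -/
lemma mem_regularSubdiff_iff {F : Vec n → EReal} {x ξ : Vec n} {a : ℝ} (ha : F x = a) :
    ξ ∈ regularSubdiff F x ↔ ∀ ε > 0, ∀ᶠ z in 𝓝 x,
      ((a + inner ℝ ξ (z - x) - ε * ‖z - x‖ : ℝ) : EReal) ≤ F z := by
  have key : ∀ (ε : ℝ) (z : Vec n), z ≠ x →
      (((-ε : ℝ) : EReal) ≤
        (F z - F x - ((inner ℝ ξ (z - x) : ℝ) : EReal)) / ((‖x - z‖ : ℝ) : EReal) ↔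
      ((a + inner ℝ ξ (z - x) - ε * ‖z - x‖ : ℝ) : EReal) ≤ F z) := by
    intro ε z hz
    have hr : (0 : EReal) < ((‖x - z‖ : ℝ) : EReal) := by
      exact_mod_cast norm_pos_iff.mpr (sub_ne_zero.mpr hz.symm)
    rw [EReal.le_div_iff_mul_le hr (EReal.coe_ne_top _), ha, ← EReal.coe_mul,
      EReal.le_sub_iff_add_le (Or.inl (EReal.coe_ne_bot _)) (Or.inl (EReal.coe_ne_top _)),
      EReal.le_sub_iff_add_le (Or.inl (EReal.coe_ne_bot _)) (Or.inl (EReal.coe_ne_top _)),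
      ← EReal.coe_add, ← EReal.coe_add, norm_sub_rev x z]
    rw [show -ε * ‖z - x‖ + inner ℝ ξ (z - x) + a = a + inner ℝ ξ (z - x) - ε * ‖z - x‖ by ring]
  have hdom : x ∈ dom F := by simp [dom, ha]
  constructor
  · rintro ⟨-, h⟩ ε hε
    rw [le_liminf_iff'] at h
    have h1 := h ((-ε : ℝ) : EReal) (by exact_mod_cast neg_lt_zero.mpr hε)
    rw [eventually_nhdsWithin_iff] at h1
    filter_upwards [h1] with z hz
    by_cases hzx : z = x
    · subst hzx; simp [ha]
    · exact (key ε z hzx).1 (hz hzx)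
  · intro h
    refine ⟨hdom, ?_⟩
    rw [le_liminf_iff']
    intro b hb
    obtain ⟨e, hbe, he⟩ := EReal.lt_iff_exists_real_btwn.1 hb
    have he' : 0 < -e := by
      have : e < 0 := by exact_mod_cast he
      linarith
    rw [eventually_nhdsWithin_iff]
    filter_upwards [h (-e) he'] with z hz hzx
    have := (key (-e) z hzx).2 hz
    rw [neg_neg] at this
    exact hbe.le.trans this

/-- A convex function bounded by `b` at `z` and by `a` at `x` lies below the chord. -/
lemma IsConvex.le_chord {F : Vec n → EReal} (hF : IsConvex F) {x z : Vec n} {a b s : ℝ}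
    (ha : F x ≤ a) (hb : F z ≤ b) (hs0 : 0 ≤ s) (hs1 : s ≤ 1) :
    F (x + s • (z - x)) ≤ ((a + s * (b - a) : ℝ) : EReal) := by
  have h := hF (x := (x, a)) ha (y := (z, b)) hb (a := 1 - s) (b := s) (by linarith) hs0 (by ring)
  have h1 : (1 - s) • x + s • z = x + s • (z - x) := by module
  have h2 : (1 - s) • a + s • b = a + s * (b - a) := by simp only [smul_eq_mul]; ring
  rw [← h1, ← h2]
  exact h

/-- The first-order term of a one-sided variation that is nonnegative for small steps. -/
lemma nonneg_of_forall_add_mul_nonneg {A B : ℝ} (h : ∀ s : ℝ, 0 < s → s ≤ 1 → 0 ≤ A + s * B) :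
    0 ≤ A := by
  have ht : Tendsto (fun s : ℝ => A + s * B) (𝓝[>] 0) (𝓝 A) := by
    have : Continuous fun s : ℝ => A + s * B := by fun_prop
    simpa using (this.tendsto 0).mono_left nhdsWithin_le_nhds
  refine ge_of_tendsto ht ?_
  filter_upwards [Ioc_mem_nhdsGT (zero_lt_one' ℝ)] with s hs using h s hs.1 hs.2

lemma IsConvex.le_of_mem_regularSubdiff {F : Vec n → EReal} (hF : IsConvex F) {x ξ : Vec n} {a : ℝ}
    (ha : F x = a) (hξ : ξ ∈ regularSubdiff F x) (z : Vec n) :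
    ((a + inner ℝ ξ (z - x) : ℝ) : EReal) ≤ F z := by
  rw [mem_regularSubdiff_iff ha] at hξ
  refine EReal.le_of_forall_lt_iff_le.1 fun b hb => ?_
  rw [EReal.coe_le_coe_iff]
  refine le_of_forall_pos_le_add fun ε hε => ?_
  -- the error `ε‖·‖` is scaled so that it contributes `ε` at `z`
  have hε' : 0 < ε / (‖z - x‖ + 1) := by positivity
  have hc : Tendsto (fun s : ℝ => x + s • (z - x)) (𝓝[>] 0) (𝓝 x) := by
    have : Continuous fun s : ℝ => x + s • (z - x) := by fun_prop
    simpa using (this.tendsto 0).mono_left nhdsWithin_le_nhds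
  obtain ⟨s, hs, hs0, hs1⟩ := ((hc.eventually (hξ _ hε')).and
    (Ioc_mem_nhdsGT (zero_lt_one' ℝ))).exists
  have h := hs.trans (hF.le_chord ha.le hb.le hs0.le hs1)
  rw [EReal.coe_le_coe_iff, add_sub_cancel_left, inner_smul_right, norm_smul, Real.norm_of_nonneg
    hs0.le] at h
  have h3 : ε / (‖z - x‖ + 1) * ‖z - x‖ ≤ ε := by
    rw [div_mul_eq_mul_div, div_le_iff₀ (by positivity)]
    nlinarith [norm_nonneg (z - x)]
  have h4 : s * (inner ℝ ξ (z - x) - ε / (‖z - x‖ + 1) * ‖z - x‖) ≤ s * (b - a) := by linarith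
  have := le_of_mul_le_mul_left h4 hs0
  linarith

/-- Limiting subgradients of a proper convex function are subgradients of convex analysis. -/
lemma IsConvex.le_of_mem_limitingSubdiff {F : Vec n → EReal} (hF : IsConvex F)
    (hbot : ∀ z, F z ≠ ⊥) {x ξ : Vec n} {a : ℝ} (ha : F x = a) (hξ : ξ ∈ limitingSubdiff F x)
    (z : Vec n) : ((a + inner ℝ ξ (z - x) : ℝ) : EReal) ≤ F z := by
  obtain ⟨-, xs, ξs, hxs, hFxs, hξs, hreg⟩ := hξ
  have hreal : ∀ k, F (xs k) = ((F (xs k)).toReal : EReal) := fun k =>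
    (EReal.coe_toReal (hreg k).1.ne (hbot _)).symm
  have hlim : Tendsto (fun k => (F (xs k)).toReal) atTop (𝓝 a) := by
    have := (EReal.tendsto_toReal (a := F x) (by simp [ha]) (by simp [ha])).comp hFxs
    simpa [ha, Function.comp_def] using this
  have hlim2 : Tendsto (fun k => (((F (xs k)).toReal + inner ℝ (ξs k) (z - xs k) : ℝ) : EReal))
      atTop (𝓝 ((a + inner ℝ ξ (z - x) : ℝ) : EReal)) :=
    (continuous_coe_real_ereal.tendsto _).comp
      (hlim.add (hξs.inner (tendsto_const_nhds.sub hxs)))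
  exact le_of_tendsto' hlim2 fun k => hF.le_of_mem_regularSubdiff (hreal k) (hreg k) z

lemma regularSubdiff_subset_limitingSubdiff (F : Vec n → EReal) (x : Vec n) :
    regularSubdiff F x ⊆ limitingSubdiff F x := fun ξ hξ =>
  ⟨hξ.1, fun _ => x, fun _ => ξ, tendsto_const_nhds, tendsto_const_nhds, tendsto_const_nhds,
    fun _ => hξ⟩

lemma mem_limitingSubdiff_of_le {F : Vec n → EReal} {x ξ : Vec n} {a : ℝ} (ha : F x = a)
    (h : ∀ z, ((a + inner ℝ ξ (z - x) : ℝ) : EReal) ≤ F z) : ξ ∈ limitingSubdiff F x := by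
  refine regularSubdiff_subset_limitingSubdiff F x ((mem_regularSubdiff_iff ha).2 ?_)
  refine fun ε hε => Eventually.of_forall fun z => le_trans ?_ (h z)
  rw [EReal.coe_le_coe_iff]
  have : 0 ≤ ε * ‖z - x‖ := by positivity
  linarith

/-- Sum rule: if `f` is differentiable at `x` and `η` is a local affine minorant slope of `g` at
`x`, then `∇f(x) + η` is a regular subgradient of `f + g`. -/
lemma grad_add_mem_regularSubdiff_objective {f g : Vec n → EReal} {x η : Vec n} {b : ℝ}
    (hf : ∀ z, f z ≠ ⊥ ∧ f z ≠ ⊤) (hdiff : DifferentiableAt ℝ (realPart f) x) (hb : g x = b)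
    (h : ∀ᶠ z in 𝓝 x, ((b + inner ℝ η (z - x) : ℝ) : EReal) ≤ g z) :
    grad f x + η ∈ regularSubdiff (objective f g) x := by
  have hfr : ∀ z, f z = (realPart f z : EReal) := fun z =>
    (EReal.coe_toReal (hf z).2 (hf z).1).symm
  have ha : objective f g x = ((realPart f x + b : ℝ) : EReal) := by
    rw [objective, hfr, hb, EReal.coe_add]
  rw [mem_regularSubdiff_iff ha]
  intro ε hε
  have hg := hasGradientAt_iff_isLittleO.1 hdiff.hasGradientAt
  filter_upwards [hg.bound hε, h] with z hz1 hz2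
  rw [objective, hfr z]
  refine le_trans ?_ (add_le_add_right hz2 _)
  rw [← EReal.coe_add, EReal.coe_le_coe_iff, inner_add_left]
  have h1 := (abs_le.1 ((Real.norm_eq_abs _).symm.le.trans hz1)).1
  simp only [grad]
  linarith

/-! ### The Hessian of the kernel -/

lemma hasFDerivAt_grad_hess {φ : Vec n → EReal} {x : Vec n} (h : ContDiffAt ℝ 2 (realPart φ) x) :
    HasFDerivAt (grad φ) (hess φ x) x := by
  -- over `ℝ` the conjugate-linear Riesz isometry is linear by definition
  let R : StrongDual ℝ (Vec n) →L[ℝ] Vec n :=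
    ((InnerProductSpace.toDual ℝ (Vec n)).symm.toContinuousLinearEquiv :
      StrongDual ℝ (Vec n) →SL[starRingEnd ℝ] Vec n)
  have h1 : DifferentiableAt ℝ (fderiv ℝ (realPart φ)) x :=
    (h.fderiv_right (m := 1) (by norm_num)).differentiableAt (by norm_num)
  have h2 : DifferentiableAt ℝ (grad φ) x := R.differentiableAt.comp x h1
  exact h2.hasFDerivAt

lemma inner_hess {φ : Vec n → EReal} {x : Vec n} (h : ContDiffAt ℝ 2 (realPart φ) x)
    (u v : Vec n) : inner ℝ (hess φ x u) v = fderiv ℝ (fderiv ℝ (realPart φ)) x u v := by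
  have h1 : DifferentiableAt ℝ (fderiv ℝ (realPart φ)) x :=
    (h.fderiv_right (m := 1) (by norm_num)).differentiableAt (by norm_num)
  have h2 : HasFDerivAt (fun z => inner ℝ (grad φ z) v)
      ((innerSL ℝ v).comp (hess φ x)) x := by
    have := (innerSL ℝ v).hasFDerivAt.comp x (hasFDerivAt_grad_hess h)
    simpa [Function.comp_def, real_inner_comm] using this
  have h3 : HasFDerivAt (fun z => inner ℝ (grad φ z) v)
      ((ContinuousLinearMap.apply ℝ ℝ v).comp (fderiv ℝ (fderiv ℝ (realPart φ)) x)) x := by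
    have := (ContinuousLinearMap.apply ℝ ℝ v).hasFDerivAt.comp x h1.hasFDerivAt
    refine this.congr_of_eventuallyEq (Eventually.of_forall fun z => ?_)
    simp [grad, inner_gradient_left]
  have := congrArg (fun A => A u) (h2.unique h3)
  simpa [real_inner_comm] using this

lemma inner_hess_comm {φ : Vec n → EReal} {x : Vec n} (h : ContDiffAt ℝ 2 (realPart φ) x)
    (u v : Vec n) : inner ℝ (hess φ x u) v = inner ℝ (hess φ x v) u := by
  rw [inner_hess h, inner_hess h]
  exact h.isSymmSndFDerivAt (by simp) u v

/-- The Hessian of a `σ`-strongly convex function dominates `σ` times the identity: along a line the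
derivative of `φ - σ/2 ‖·‖²` is monotone. -/
lemma le_inner_hess_of_strongConvexOn {C : Set (Vec n)} {φ : Vec n → EReal} {σ : ℝ}
    (hC : IsOpen C) (hφ : ContDiffOn ℝ 2 (realPart φ) C)
    (hs : StrongConvexOn C σ (realPart φ)) {x : Vec n} (hx : x ∈ C) (d : Vec n) :
    σ * ‖d‖ ^ 2 ≤ inner ℝ (hess φ x d) d := by
  have hcd : ∀ z ∈ C, ContDiffAt ℝ 2 (realPart φ) z := fun z hz => hφ.contDiffAt (hC.mem_nhds hz)
  let ℓ : ℝ →ᵃ[ℝ] Vec n := AffineMap.lineMap x (x + d)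
  have hℓ : ∀ s, ℓ s = x + s • d := fun s => by simp [ℓ, AffineMap.lineMap_apply, add_comm]
  have hℓd : ∀ s, HasDerivAt ℓ d s := fun s => by
    have : HasDerivAt (fun s : ℝ => x + s • d) ((1 : ℝ) • d) s :=
      ((hasDerivAt_id s).smul_const d).const_add x
    rw [one_smul] at this
    exact this.congr_of_eventuallyEq (Eventually.of_forall hℓ)
  have hSo : IsOpen (ℓ ⁻¹' C) :=
    hC.preimage (continuous_iff_continuousAt.2 fun s => (hℓd s).continuousAt)
  have h0 : (0 : ℝ) ∈ ℓ ⁻¹' C := by simpa [hℓ] using hx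
  have hconv := (strongConvexOn_iff_convex.1 hs).comp_affineMap ℓ
  have hder : ∀ s ∈ ℓ ⁻¹' C, HasDerivAt ((fun z => realPart φ z - σ / 2 * ‖z‖ ^ 2) ∘ ℓ)
      (inner ℝ (grad φ (ℓ s)) d - σ * inner ℝ (ℓ s) d) s := by
    intro s hs
    have h1 := (((hcd _ hs).differentiableAt (by norm_num)).hasFDerivAt).comp_hasDerivAt s (hℓd s)
    have h2 := ((hℓd s).norm_sq).const_mul (σ / 2)
    have e : inner ℝ (grad φ (ℓ s)) d - σ * inner ℝ (ℓ s) d =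
        fderiv ℝ (realPart φ) (ℓ s) d - σ / 2 * (2 * inner ℝ (ℓ s) d) := by
      simp only [grad, inner_gradient_left]
      ring
    rw [e]
    exact h1.sub h2
  have hmono := hconv.monotoneOn_deriv fun s hs => (hder s hs).differentiableAt
  have hmono' : MonotoneOn (fun s => inner ℝ (grad φ (ℓ s)) d - σ * inner ℝ (ℓ s) d) (ℓ ⁻¹' C) :=
    hmono.congr fun s hs => (hder s hs).deriv
  have hx0 : ℓ 0 = x := by simp [hℓ]
  have hq : HasDerivAt (fun s => inner ℝ (grad φ (ℓ s)) d - σ * inner ℝ (ℓ s) d)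
      (inner ℝ (hess φ x d) d - σ * ‖d‖ ^ 2) 0 := by
    have hg : HasFDerivAt (grad φ) (hess φ x) (ℓ 0) := by
      rw [hx0]; exact hasFDerivAt_grad_hess (hcd x hx)
    have h1 := (hg.comp_hasDerivAt (0 : ℝ) (hℓd 0)).inner ℝ (hasDerivAt_const (0 : ℝ) d)
    have h2 := ((hℓd 0).inner ℝ (hasDerivAt_const (0 : ℝ) d)).const_mul σ
    have e : inner ℝ (hess φ x d) d - σ * ‖d‖ ^ 2 =
        inner ℝ ((grad φ ∘ ℓ) 0) 0 + inner ℝ (hess φ x d) d -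
          σ * (inner ℝ (ℓ 0) 0 + inner ℝ d d) := by
      simp
    rw [e]
    exact h1.sub h2
  have := hmono'.derivWithin_nonneg (x := 0)
  rw [hSo.uniqueDiffWithinAt h0 |> hq.hasDerivWithinAt.derivWithin] at this
  linarith

/-! ### The subproblem -/

/-- Optimality condition of the subproblem: a minimizer `y` over `cl C` comes with the
convex subgradient `-(∇f(x) + λ⁻¹ ∇²φ(x)(y - x))` of `g + δ_{cl C}`. -/
lemma le_of_mem_proxMap {C : Set (Vec n)} {f g φ : Vec n → EReal} {lam : ℝ} {x y : Vec n} {b : ℝ}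
    (hlam : 0 < lam) (hC : Convex ℝ C) (hg : IsConvex g)
    (hφ : ContDiffAt ℝ 2 (realPart φ) x) (hy : y ∈ proxMap C f g φ lam x) (hb : g y = b)
    {z : Vec n} (hz : z ∈ closure C) :
    ((b + inner ℝ (-(grad f x + lam⁻¹ • hess φ x (y - x))) (z - y) : ℝ) : EReal) ≤ g z := by
  refine EReal.le_of_forall_lt_iff_le.1 fun c hc => ?_
  rw [EReal.coe_le_coe_iff]
  rw [← sub_nonneg]
  refine nonneg_of_forall_add_mul_nonneg
    (B := 1 / (2 * lam) * inner ℝ (hess φ x (z - y)) (z - y)) fun s hs0 hs1 => ?_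
  have hu : y + s • (z - y) ∈ closure C :=
    hC.closure.add_smul_sub_mem hy.1 hz ⟨hs0.le, hs1⟩
  have h1 := hy.2 hu
  have h2 : subObjective f g φ lam x (y + s • (z - y)) ≤
      ((inner ℝ (grad f x) (y + s • (z - y) - x) + (b + s * (c - b)) +
        1 / lam * approxBregman φ (y + s • (z - y)) x : ℝ) : EReal) := by
    rw [EReal.coe_add, EReal.coe_add]
    exact add_le_add_left (add_le_add_right
      (hg.le_chord hb.le hc.le hs0.le hs1) _) _
  have h3 : subObjective f g φ lam x y = ((inner ℝ (grad f x) (y - x) + b +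
        1 / lam * approxBregman φ y x : ℝ) : EReal) := by
    rw [EReal.coe_add, EReal.coe_add, ← hb]; rfl
  have h4 := (h3.symm.le.trans h1).trans h2
  rw [EReal.coe_le_coe_iff] at h4
  have e1 : y + s • (z - y) - x = (y - x) + s • (z - y) := by abel
  have hsymm := inner_hess_comm hφ (z - y) (y - x)
  simp only [approxBregman, e1, inner_add_right, inner_add_left, map_add, map_smul,
    real_inner_smul_left, real_inner_smul_right] at h4
  rw [hsymm] at h4
  refine nonneg_of_mul_nonneg_right ?_ hs0
  simp only [inner_neg_left, inner_add_left, real_inner_smul_left]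
  have e2 : 1 / lam = lam⁻¹ := one_div _
  have e3 : 1 / (2 * lam) = lam⁻¹ / 2 := by field_simp
  rw [e2] at h4
  rw [e3]
  linarith

/-! ### Desingularizing functions and the Kurdyka–Łojasiewicz recursion -/

/-- The derivative of a desingularizing function at a point bounds from below its slopes to the
left. -/
lemma IsDesingularizing.deriv_mul_sub_le {v : EReal} {ψ : ℝ → ℝ} (h : IsDesingularizing v ψ)
    {r s q : ℝ} (hr : 0 ≤ r) (hrs : r ≤ s) (hsq : s ≤ q) (hs : 0 < s) (hq : (q : EReal) < v) :
    deriv ψ q * (s - r) ≤ ψ s - ψ r := by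
  rcases hrs.eq_or_lt with rfl | hlt
  · simp
  have hlt' : ∀ {p : ℝ}, p ≤ q → (p : EReal) < v := fun hp =>
    (EReal.coe_le_coe_iff.2 hp).trans_lt hq
  have hrmem : r ∈ {s : ℝ | 0 ≤ s ∧ (s : EReal) < v} := ⟨hr, hlt' (hrs.trans hsq)⟩
  have hsmem : s ∈ {s : ℝ | 0 ≤ s ∧ (s : EReal) < v} := ⟨hs.le, hlt' hsq⟩
  have hqmem : q ∈ {s : ℝ | 0 ≤ s ∧ (s : EReal) < v} := ⟨hs.le.trans hsq, hq⟩
  -- a nonzero derivative forces differentiability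
  have hd : DifferentiableAt ℝ ψ q := by
    by_contra hn
    have := h.deriv_pos q (hs.trans_le hsq) hq
    rw [deriv_zero_of_not_differentiableAt hn] at this
    exact lt_irrefl _ this
  have h1 : deriv ψ q ≤ slope ψ r q :=
    h.concaveOn.deriv_le_slope hrmem hqmem (hlt.trans_le hsq) hd
  have h2 : slope ψ r q ≤ slope ψ r s :=
    h.concaveOn.antitoneOn_slope_gt hrmem ⟨hsmem, hlt⟩ ⟨hqmem, hlt.trans_le hsq⟩ hsq
  have h3 := h1.trans h2
  rwa [slope_def_field, le_div_iff₀ (sub_pos.2 hlt)] at h3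

lemma IsDesingularizing.tendsto_zero {v : EReal} {ψ : ℝ → ℝ} (h : IsDesingularizing v ψ)
    {r : ℕ → ℝ} (hr : ∀ k, 0 ≤ r k) (hr0 : Tendsto r atTop (𝓝 0))
    (hrv : ∀ᶠ k in atTop, (r k : EReal) < v) : Tendsto (fun k => ψ (r k)) atTop (𝓝 0) := by
  obtain ⟨k, hk⟩ := hrv.exists
  have h0 : (0 : ℝ) ∈ {s : ℝ | 0 ≤ s ∧ (s : EReal) < v} :=
    ⟨le_rfl, (EReal.coe_le_coe_iff.2 (hr k)).trans_lt hk⟩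
  have hc := h.continuousOn 0 h0
  rw [ContinuousWithinAt, h.zero] at hc
  refine hc.comp (tendsto_nhdsWithin_iff.2 ⟨hr0, ?_⟩)
  filter_upwards [hrv] with k hk using ⟨hr k, hk⟩

/-- One step of the KL argument. Here `s`, `r` are the gaps of the objective at two consecutive
iterates, `q` is the gap at the previous trial point, and `a`, `b` are consecutive step lengths:
concavity turns the decrease `ρ₁ b² ≤ s - r` into a decrease of `ψ` by at least `b² / a` up to the
factor `ρ₁ / ρ₂`, and the claim is the inequality of arithmetic and geometric means. -/
lemma IsDesingularizing.two_mul_le {v : EReal} {ψ : ℝ → ℝ} (h : IsDesingularizing v ψ)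
    {r s q a b ρ₁ ρ₂ : ℝ} (hr : 0 ≤ r) (hsq : s ≤ q) (hs : 0 < s) (hq : (q : EReal) < v)
    (hρ₁ : 0 < ρ₁) (hρ₂ : 0 < ρ₂) (ha : 0 ≤ a) (hb : 0 ≤ b) (hdec : ρ₁ * b ^ 2 ≤ s - r)
    (hKL : 1 ≤ deriv ψ q * (ρ₂ * a)) : 2 * b ≤ a + ρ₂ / ρ₁ * (ψ s - ψ r) := by
  have hrs : r ≤ s := by nlinarith [mul_nonneg hρ₁.le (sq_nonneg b)]
  have h1 := h.deriv_mul_sub_le hr hrs hsq hs hq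
  have hp := h.deriv_pos q (hs.trans_le hsq) hq
  set D := ψ s - ψ r with hD
  have h2 : deriv ψ q * (ρ₁ * b ^ 2) ≤ D := (mul_le_mul_of_nonneg_left hdec hp.le).trans h1
  have hD0 : 0 ≤ D := le_trans (by positivity) h2
  have h3 : ρ₁ * b ^ 2 ≤ ρ₂ * a * D := by
    calc ρ₁ * b ^ 2 ≤ (deriv ψ q * (ρ₂ * a)) * (ρ₁ * b ^ 2) :=
          le_mul_of_one_le_left (by positivity) hKL
      _ = ρ₂ * a * (deriv ψ q * (ρ₁ * b ^ 2)) := by ring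
      _ ≤ ρ₂ * a * D := mul_le_mul_of_nonneg_left h2 (by positivity)
  have h4 : b ^ 2 ≤ a * (ρ₂ / ρ₁ * D) := by
    have : a * (ρ₂ / ρ₁ * D) = ρ₂ * a * D / ρ₁ := by ring
    rw [this, le_div_iff₀ hρ₁]
    linarith
  have hX : 0 ≤ ρ₂ / ρ₁ * D := by positivity
  refine (pow_le_pow_iff_left₀ (by positivity) (by positivity) two_ne_zero).1 ?_
  nlinarith [sq_nonneg (a - ρ₂ / ρ₁ * D)]

lemma sum_Icc_sub_succ (S : ℕ → ℝ) (a k : ℕ) :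
    ∑ i ∈ Finset.Icc (a + 1) (a + k), (S i - S (i + 1)) = S (a + 1) - S (a + k + 1) := by
  induction k with
  | zero => simp
  | succ k ih =>
    rw [← add_assoc, Finset.sum_Icc_succ_top (by omega), ih]
    ring

/-- Once the iterates are close enough to a cluster point, the recursion
`2 ‖Δ_m‖ ≤ ‖Δ_{m-1}‖ + S_m - S_{m+1}`, known only while the iterates are in the ball, keeps them
there: the summed inequality bounds the remaining path length. -/
lemma exists_stays_in_closedBall {E : Type*} [NormedAddCommGroup E] {x y : ℕ → E} {S : ℕ → ℝ}
    {xbar : E} {ρ : ℝ} (hρ : 0 < ρ) (hcl : MapClusterPt xbar atTop x)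
    (hδ : Tendsto (fun k => ‖x (k + 1) - x k‖) atTop (𝓝 0))
    (hyx : Tendsto (fun k => dist (y k) (x k)) atTop (𝓝 0))
    (hS : Tendsto S atTop (𝓝 0)) (hS0 : ∀ᶠ k in atTop, 0 ≤ S k)
    (hstep : ∃ K : ℕ, ∀ k₀ ≥ K, ∀ k ≥ 1, x (k₀ + k) ∈ Metric.closedBall xbar ρ →
      y (k₀ + k - 1) ∈ Metric.closedBall xbar ρ →
      2 * ‖x (k₀ + k + 1) - x (k₀ + k)‖ ≤
        ‖x (k₀ + k) - x (k₀ + k - 1)‖ + (S (k₀ + k) - S (k₀ + k + 1))) :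
    ∃ k₀ : ℕ, ∀ k,
      (1 ≤ k → x (k₀ + k) ∈ Metric.closedBall xbar ρ ∧
        y (k₀ + k - 1) ∈ Metric.closedBall xbar ρ) ∧
      (∑ i ∈ Finset.Icc (k₀ + 1) (k₀ + k), ‖x (i + 1) - x i‖) + ‖x (k₀ + k + 1) - x (k₀ + k)‖ ≤
        ‖x (k₀ + 1) - x k₀‖ + ∑ i ∈ Finset.Icc (k₀ + 1) (k₀ + k), (S i - S (i + 1)) ∧
      ∑ i ∈ Finset.Icc (k₀ + 1) (k₀ + k), ‖x (i + 1) - x i‖ ≤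
        ‖x (k₀ + 1) - x k₀‖ + S (k₀ + 1) := by
  obtain ⟨K₁, hK₁⟩ := hstep
  obtain ⟨K₂, hK₂⟩ := eventually_atTop.1 (hS0.and (hyx.eventually_le_const (half_pos hρ)))
  have hρ8 : 0 < ρ / 8 := by positivity
  obtain ⟨k₀, ⟨hx0, hδ0⟩, hk₀, hS1⟩ := (((hcl.frequently
    (Metric.closedBall_mem_nhds xbar hρ8)).and_eventually (hδ.eventually_le_const hρ8)).and_eventually
    ((eventually_ge_atTop (max K₁ K₂)).and
      ((hS.comp (tendsto_add_atTop_nat 1)).eventually_le_const hρ8))).exists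
  have hk₁ : K₁ ≤ k₀ := (le_max_left _ _).trans hk₀
  have hk₂ : K₂ ≤ k₀ := (le_max_right _ _).trans hk₀
  simp only [Function.comp_apply] at hS1
  have hyball : ∀ j, dist (x (k₀ + j)) xbar ≤ ρ / 2 → y (k₀ + j) ∈ Metric.closedBall xbar ρ := by
    intro j hj
    have := (hK₂ (k₀ + j) (by omega)).2
    rw [Metric.mem_closedBall]
    linarith [dist_triangle (y (k₀ + j)) (x (k₀ + j)) xbar]
  have main : ∀ k,
      dist (x (k₀ + k + 1)) xbar ≤ dist (x k₀) xbar + ‖x (k₀ + 1) - x k₀‖ +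
        ∑ i ∈ Finset.Icc (k₀ + 1) (k₀ + k), ‖x (i + 1) - x i‖ ∧
      (∑ i ∈ Finset.Icc (k₀ + 1) (k₀ + k), ‖x (i + 1) - x i‖) + ‖x (k₀ + k + 1) - x (k₀ + k)‖ ≤
        ‖x (k₀ + 1) - x k₀‖ + ∑ i ∈ Finset.Icc (k₀ + 1) (k₀ + k), (S i - S (i + 1)) ∧
      dist (x (k₀ + k)) xbar ≤ ρ / 2 := by
    intro k
    induction k with
    | zero =>
      refine ⟨?_, by simp, by simp only [add_zero]; linarith⟩
      have := dist_triangle (x (k₀ + 1)) (x k₀) xbar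
      rw [dist_eq_norm (x (k₀ + 1)) (x k₀)] at this
      simp only [add_zero, Nat.lt_add_one, Finset.Icc_eq_empty_of_lt, Finset.sum_empty]
      linarith
    | succ k ih =>
      obtain ⟨h1, h2, h3⟩ := ih
      have hS2 := (hK₂ (k₀ + k + 1) (by omega)).1
      have hx1 : dist (x (k₀ + k + 1)) xbar ≤ ρ / 2 := by
        rw [sum_Icc_sub_succ] at h2
        linarith [norm_nonneg (x (k₀ + k + 1) - x (k₀ + k))]
      have hst := hK₁ k₀ hk₁ (k + 1) (by omega)
        (by rw [Metric.mem_closedBall, ← add_assoc]; linarith) (hyball k h3)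
      have htri := dist_triangle (x (k₀ + k + 1 + 1)) (x (k₀ + k + 1)) xbar
      rw [dist_eq_norm (x (k₀ + k + 1 + 1)) (x (k₀ + k + 1))] at htri
      simp only [← add_assoc, Nat.add_sub_cancel] at hst ⊢
      rw [Finset.sum_Icc_succ_top (by omega), Finset.sum_Icc_succ_top (by omega)]
      exact ⟨by linarith, by linarith, hx1⟩
  refine ⟨k₀, fun k => ⟨fun hk => ?_, (main k).2.1, ?_⟩⟩
  · obtain ⟨j, rfl⟩ := Nat.exists_eq_add_of_le' hk
    refine ⟨?_, hyball j (main j).2.2⟩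
    rw [Metric.mem_closedBall]
    linarith [(main (j + 1)).2.2]
  · have h2 := (main k).2.1
    rw [sum_Icc_sub_succ] at h2
    have hS2 := (hK₂ (k₀ + k + 1) (by omega)).1
    linarith [norm_nonneg (x (k₀ + k + 1) - x (k₀ + k))]

lemma summable_of_sum_Icc_le {δ : ℕ → ℝ} (hδ : ∀ k, 0 ≤ δ k) {k₀ : ℕ} {B : ℝ}
    (h : ∀ k, ∑ i ∈ Finset.Icc (k₀ + 1) (k₀ + k), δ i ≤ B) : Summable δ := by
  rw [← summable_nat_add_iff (k₀ + 1)]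
  refine summable_of_sum_range_le (c := B) (fun k => hδ _) fun k => ?_
  have e : ∑ i ∈ Finset.range k, δ (i + (k₀ + 1)) = ∑ i ∈ Finset.Icc (k₀ + 1) (k₀ + k), δ i := by
    induction k with
    | zero => simp
    | succ k ih =>
      rw [Finset.sum_range_succ, ih, ← add_assoc k₀ k, Finset.sum_Icc_succ_top (by omega)]
      congr 2; omega
  rw [e]
  exact h k

lemma tendsto_of_summable_of_mapClusterPt {E : Type*} [NormedAddCommGroup E] {x : ℕ → E}
    {xbar : E} (hs : Summable fun k => ‖x (k + 1) - x k‖) (hcl : MapClusterPt xbar atTop x) :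
    Tendsto x atTop (𝓝 xbar) := by
  have : CauchySeq x := cauchySeq_of_summable_dist (by simpa [dist_eq_norm'] using hs)
  exact le_nhds_of_cauchy_adhp this hcl

/-! ### One iteration of the algorithm -/

/-- The real-valued objective; it agrees with `objective` wherever `g` is finite, see
`objective_eq_coe`. -/
noncomputable def realObjective (f g : Vec n → EReal) (z : Vec n) : ℝ := realPart f z + realPart g z

lemma coe_realPart {F : Vec n → EReal} {z : Vec n} (hbot : F z ≠ ⊥) (htop : F z ≠ ⊤) :
    F z = (realPart F z : EReal) := (EReal.coe_toReal htop hbot).symm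

lemma objective_eq_coe {f g : Vec n → EReal} (hf : GradLipschitzOnCompacts f) {z : Vec n}
    (hbot : g z ≠ ⊥) (htop : g z ≠ ⊤) : objective f g z = (realObjective f g z : EReal) := by
  rw [objective, coe_realPart (hf.finite z).1 (hf.finite z).2, coe_realPart hbot htop, realObjective,
    EReal.coe_add]

lemma GradLipschitzOnCompacts.continuous_grad {f : Vec n → EReal}
    (hf : GradLipschitzOnCompacts f) : Continuous (grad f) := by
  refine continuous_iff_continuousAt.2 fun z => ?_
  obtain ⟨L, hL⟩ := hf.lipschitz _ (isCompact_closedBall z 1)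
  exact hL.continuousOn.continuousAt (Metric.closedBall_mem_nhds z one_pos)

/-- Where the Armijo condition holds, the objective is finite at the line search point and the
condition is an inequality between real numbers: otherwise its left-hand side would be `+∞`. -/
lemma of_armijo_neg {C : Set (Vec n)} {f g φ : Vec n → EReal} {lam c₁ t : ℝ} {x d : Vec n}
    (hf : GradLipschitzOnCompacts f) (hg : ∀ z, g z ≠ ⊥) (hx : g x ≠ ⊤) (hy : g (x + d) ≠ ⊤)
    (h : armijo C f g φ lam c₁ x d t < 0) :
    g (x + t • d) ≠ ⊤ ∧ realObjective f g (x + t • d) < realObjective f g x +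
      c₁ * t * (inner ℝ (grad f x) d + realPart g (x + d) - realPart g x +
        1 / (2 * lam) * inner ℝ (hess φ x d) d) := by
  rw [armijo, objective_eq_coe hf (hg x) hx, coe_realPart (hg x) hx, coe_realPart (hg _) hy,
    ← EReal.coe_add, ← EReal.coe_sub, ← EReal.coe_add, ← EReal.coe_mul] at h
  have hO : objective f g (x + t • d) ≠ ⊥ := by
    simp [objective, EReal.add_eq_bot_iff, (hf.finite _).1, hg]
  by_cases htop : objective f g (x + t • d) + indicatorFn (closure C) (x + t • d) = ⊤
  · rw [htop, EReal.top_sub_coe, EReal.top_sub_coe] at h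
    exact absurd h not_top_lt
  have hmem : x + t • d ∈ closure C := by
    by_contra hn
    exact htop (by rw [indicatorFn, if_neg hn, EReal.add_top_of_ne_bot hO])
  rw [indicatorFn, if_pos hmem, add_zero] at h htop
  have hgt : g (x + t • d) ≠ ⊤ := fun hn =>
    htop (by rw [objective, hn, EReal.add_top_of_ne_bot (hf.finite _).1])
  refine ⟨hgt, ?_⟩
  rw [objective_eq_coe hf (hg _) hgt, ← EReal.coe_sub, ← EReal.coe_sub, ← EReal.coe_zero,
    EReal.coe_lt_coe_iff] at h
  linarith

/-- The Wolfe condition forces the curvature of `f` along the step to dominate that of the model. -/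
lemma curvature_of_wolfe {f : Vec n → EReal} {c₂ t q : ℝ} {x d ξ : Vec n} (hc₂ : c₂ < 1)
    (hdir : inner ℝ (grad f x + ξ) d ≤ -q) (h : 0 < wolfe f c₂ x d ξ t) :
    (1 - c₂) * q < inner ℝ (grad f (x + t • d) - grad f x) d := by
  rw [wolfe] at h
  simp only [inner_add_left, inner_sub_left] at h hdir ⊢
  nlinarith [mul_nonneg (sub_nonneg.2 hc₂.le) (sub_nonneg.2 hdir)]

/-! ### Uniform estimates along the iteration -/

/-- What the convergence analysis uses of a run of the algorithm: the iterates `x` and trial points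
`y` in `C`, subgradients `η k` of `g + δ_{cl C}` at `y k`, and uniform constants. -/
structure IsDescentRun (C : Set (Vec n)) (f g : Vec n → EReal) (x y η : ℕ → Vec n)
    (ρ₁ ρ₂ κ : ℝ) : Prop where
  x_mem : ∀ k, x k ∈ C
  y_mem : ∀ k, y k ∈ C
  bounded : Bornology.IsBounded (range x)
  step_ne : ∀ k, x (k + 1) ≠ x k
  decrease : ∀ k, realObjective f g (x (k + 1)) + ρ₁ * ‖x (k + 1) - x k‖ ^ 2 ≤
    realObjective f g (x k)
  le_trial : ∀ k, realObjective f g (x (k + 1)) ≤ realObjective f g (y k)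
  trial_descent : ∀ k, inner ℝ (grad f (x k)) (y k - x k) + realPart g (y k) ≤ realPart g (x k)
  norm_trial_sub_le : ∀ k, ‖y k - x k‖ ≤ κ * ‖x (k + 1) - x k‖
  subgradient : ∀ k, ∀ z ∈ closure C,
    ((realPart g (y k) + inner ℝ (η k) (z - y k) : ℝ) : EReal) ≤ g z
  residual : ∀ k, ‖grad f (y k) + η k‖ ≤ ρ₂ * ‖x (k + 1) - x k‖

/-- The generated sequences satisfy the uniform estimates: strong convexity of the kernel makes
`d k` a descent direction with slope at most `-σ/λ ‖d k‖²`, the Wolfe condition and local Lipschitz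
continuity of `∇f` bound the step sizes away from zero, and everything takes place in a bounded
level set. -/
lemma IsGenerated.exists_isDescentRun {C : Set (Vec n)} {f g φ : Vec n → EReal}
    (hbasic : BasicAssumptions C f g φ) (hfeas : Feasible C f g φ)
    {σ : ℝ} (hσ : 0 < σ) (hstrong : StrongConvexOn C σ (realPart φ))
    (hlevel : LevelBounded (objective f g)) (hLip : GradLipschitzOnCompacts f)
    {lam c₁ c₂ : ℝ} (hlam : 0 < lam) (hc₁ : 0 < c₁) (hc₂ : c₂ < 1)
    {x y d ξ : ℕ → Vec n} {t : ℕ → ℝ} (hgen : IsGenerated C f g φ lam c₁ c₂ x y d ξ t)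
    {tbar : ℝ} (ht : ∀ k, t k < tbar) {M : ℝ} (hhess : ∀ k, ‖hess φ (x k)‖ ≤ M) :
    ∃ (η : ℕ → Vec n) (ρ₁ ρ₂ κ : ℝ), 0 < ρ₁ ∧ 0 < ρ₂ ∧ IsDescentRun C f g x y η ρ₁ ρ₂ κ := by
  have hg : ∀ z, g z ≠ ⊥ := hbasic.g_proper.1
  have hgC : ∀ z ∈ C, g z ≠ ⊤ := fun z hz => (hbasic.g_dom hz).ne
  have hobj : ∀ z, g z ≠ ⊤ → objective f g z = (realObjective f g z : EReal) :=
    fun z hz => objective_eq_coe hLip (hg z) hz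
  have hxC := hgen.mem
  have hyC : ∀ k, y k ∈ C := fun k => hfeas _ (hxC k) lam hlam (hgen.subproblem k)
  have hφ : ∀ k, ContDiffAt ℝ 2 (realPart φ) (x k) := fun k =>
    hbasic.kernel_contDiffOn.contDiffAt (hbasic.C_open.mem_nhds (hxC k))
  have hxd : ∀ k, x k + d k = y k := fun k => by rw [hgen.direction]; abel
  have hH : ∀ k, σ * ‖d k‖ ^ 2 ≤ inner ℝ (hess φ (x k) (d k)) (d k) := fun k =>
    le_inner_hess_of_strongConvexOn hbasic.C_open hbasic.kernel_contDiffOn hstrong (hxC k) _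
  set η : ℕ → Vec n := fun k => -(grad f (x k) + lam⁻¹ • hess φ (x k) (d k)) with hη
  have hsub : ∀ k, ∀ z ∈ closure C,
      ((realPart g (y k) + inner ℝ (η k) (z - y k) : ℝ) : EReal) ≤ g z := by
    intro k z hz
    have := le_of_mem_proxMap hlam hbasic.C_convex hbasic.g_convex (hφ k) (hgen.subproblem k)
      (coe_realPart (hg _) (hgC _ (hyC k))) hz
    rwa [← hgen.direction k] at this
  -- the optimality condition of the subproblem, tested at `x k`
  have hdesc : ∀ k, inner ℝ (grad f (x k)) (d k) + realPart g (y k) - realPart g (x k) ≤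
      -(lam⁻¹ * inner ℝ (hess φ (x k) (d k)) (d k)) := by
    intro k
    have h := hsub k (x k) (subset_closure (hxC k))
    rw [coe_realPart (hg _) (hgC _ (hxC k)), EReal.coe_le_coe_iff,
      show x k - y k = -d k by rw [hgen.direction]; abel] at h
    simp only [hη, inner_neg_left, inner_neg_right, inner_add_left, real_inner_smul_left] at h
    linarith
  have hHq : ∀ k, 0 ≤ lam⁻¹ * inner ℝ (hess φ (x k) (d k)) (d k) := fun k =>
    mul_nonneg (inv_pos.2 hlam).le (le_trans (by positivity) (hH k))
  have hHq' : ∀ k, lam⁻¹ * (σ * ‖d k‖ ^ 2) ≤ lam⁻¹ * inner ℝ (hess φ (x k) (d k)) (d k) :=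
    fun k => mul_le_mul_of_nonneg_left (hH k) (inv_pos.2 hlam).le
  have harm : ∀ k, g (x k + t k • d k) ≠ ⊤ ∧ realObjective f g (x k + t k • d k) ≤
      realObjective f g (x k) - c₁ * t k * (σ / (2 * lam) * ‖d k‖ ^ 2) := by
    intro k
    obtain ⟨h1, h2⟩ := of_armijo_neg hLip hg (hgC _ (hxC k))
      (by rw [hxd]; exact hgC _ (hyC k)) (hgen.step_armijo k)
    refine ⟨h1, ?_⟩
    rw [hxd] at h2
    have e1 : 1 / (2 * lam) = lam⁻¹ / 2 := by field_simp
    have e2 : σ / (2 * lam) * ‖d k‖ ^ 2 = lam⁻¹ * (σ * ‖d k‖ ^ 2) / 2 := by field_simp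
    rw [e1] at h2
    rw [e2]
    have h3 : 0 ≤ c₁ * t k := (mul_pos hc₁ (hgen.step_pos k)).le
    have h4 := mul_le_mul_of_nonneg_left (a := c₁ * t k) (b := inner ℝ (grad f (x k)) (d k) +
      realPart g (y k) - realPart g (x k) + lam⁻¹ / 2 * inner ℝ (hess φ (x k) (d k)) (d k))
      (c := -(lam⁻¹ * (σ * ‖d k‖ ^ 2) / 2)) (by linarith [hdesc k, hHq' k]) h3
    linarith
  -- the better of the two candidates is chosen
  have hupd : ∀ k, (x (k + 1) = y k ∨ x (k + 1) = x k + t k • d k) ∧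
      realObjective f g (x (k + 1)) ≤ realObjective f g (x k + t k • d k) ∧
      realObjective f g (x (k + 1)) ≤ realObjective f g (y k) := by
    intro k
    rw [hgen.update k]
    have e1 := hobj _ (harm k).1
    have e2 := hobj _ (hgC _ (hyC k))
    split_ifs with hlt
    · rw [e1, e2, EReal.coe_lt_coe_iff] at hlt
      exact ⟨Or.inl rfl, hlt.le, le_rfl⟩
    · rw [e1, e2, EReal.coe_lt_coe_iff] at hlt
      exact ⟨Or.inr rfl, le_rfl, not_lt.1 hlt⟩
  have hmono1 : ∀ k, realObjective f g (x k + t k • d k) ≤ realObjective f g (x k) := fun k => by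
    have h3 := hgen.step_pos k
    have : 0 ≤ c₁ * t k * (σ / (2 * lam) * ‖d k‖ ^ 2) := by positivity
    linarith [(harm k).2]
  have hanti : Antitone fun k => realObjective f g (x k) :=
    antitone_nat_of_succ_le fun k => (hupd k).2.1.trans (hmono1 k)
  obtain ⟨R, hR⟩ := (hlevel (realObjective f g (x 0))).subset_closedBall 0
  have hball : ∀ z, g z ≠ ⊤ → realObjective f g z ≤ realObjective f g (x 0) →
      z ∈ Metric.closedBall (0 : Vec n) R := fun z hz hle =>
    hR (by rw [mem_ofPred_eq, hobj z hz]; exact EReal.coe_le_coe_iff.2 hle)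
  have hxR : ∀ k, x k ∈ Metric.closedBall (0 : Vec n) R := fun k =>
    hball _ (hgC _ (hxC k)) (hanti (Nat.zero_le k))
  have htR : ∀ k, x k + t k • d k ∈ Metric.closedBall (0 : Vec n) R := fun k =>
    hball _ (harm k).1 ((hmono1 k).trans (hanti (Nat.zero_le k)))
  obtain ⟨L, hL⟩ := hLip.lipschitz _ (isCompact_closedBall (0 : Vec n) R)
  have hwolfe : ∀ k, (1 - c₂) * (lam⁻¹ * (σ * ‖d k‖ ^ 2)) < L * t k * ‖d k‖ ^ 2 := by
    intro k
    have hxi := hbasic.g_convex.le_of_mem_limitingSubdiff hg (coe_realPart (hg _) (hgC _ (hxC k)))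
      (hgen.subgradient k) (y k)
    rw [coe_realPart (hg _) (hgC _ (hyC k)), EReal.coe_le_coe_iff, ← hgen.direction k] at hxi
    have h1 := curvature_of_wolfe (q := lam⁻¹ * inner ℝ (hess φ (x k) (d k)) (d k)) hc₂
      (by rw [inner_add_left]; linarith [hdesc k]) (hgen.step_wolfe k)
    have h2 : inner ℝ (grad f (x k + t k • d k) - grad f (x k)) (d k) ≤ L * t k * ‖d k‖ ^ 2 := by
      refine (real_inner_le_norm _ _).trans ?_
      have h3 := hL.dist_le_mul _ (htR k) _ (hxR k)
      rw [dist_eq_norm, dist_eq_norm, add_sub_cancel_left, norm_smul,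
        Real.norm_of_nonneg (hgen.step_pos k).le] at h3
      calc _ ≤ L * (t k * ‖d k‖) * ‖d k‖ := mul_le_mul_of_nonneg_right h3 (norm_nonneg _)
        _ = _ := by ring
    have h4 := mul_le_mul_of_nonneg_left (hHq' k) (sub_nonneg.2 hc₂.le)
    linarith
  have hd0 : ∀ k, 0 < ‖d k‖ := fun k => by
    refine (norm_nonneg _).lt_of_ne' fun h0 => ?_
    have := hwolfe k
    simp [h0] at this
  -- `L + 1` instead of `L`, as `L` may vanish
  set τ : ℝ := (1 - c₂) * (lam⁻¹ * σ) / (L + 1) with hτ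
  have hL1 : (0 : ℝ) < L + 1 := by positivity
  have hc2' : 0 < 1 - c₂ := sub_pos.2 hc₂
  have hτ0 : 0 < τ := by positivity
  have hτt : ∀ k, τ ≤ t k := by
    intro k
    have h1 : (1 - c₂) * (lam⁻¹ * σ) < L * t k := by
      refine lt_of_mul_lt_mul_right ?_ (sq_nonneg ‖d k‖)
      calc _ = (1 - c₂) * (lam⁻¹ * (σ * ‖d k‖ ^ 2)) := by ring
        _ < _ := hwolfe k
    rw [hτ, div_le_iff₀ hL1]
    linarith [hgen.step_pos k]
  have hstep : ∀ k, ‖x (k + 1) - x k‖ ≤ max 1 tbar * ‖d k‖ ∧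
      min 1 τ * ‖d k‖ ≤ ‖x (k + 1) - x k‖ := by
    intro k
    rcases (hupd k).1 with h | h <;> rw [h]
    · rw [← hgen.direction k]
      exact ⟨le_mul_of_one_le_left (norm_nonneg _) (le_max_left _ _),
        mul_le_of_le_one_left (norm_nonneg _) (min_le_left _ _)⟩
    · rw [add_sub_cancel_left, norm_smul, Real.norm_of_nonneg (hgen.step_pos k).le]
      exact ⟨mul_le_mul_of_nonneg_right ((ht k).le.trans (le_max_right _ _)) (norm_nonneg _),
        mul_le_mul_of_nonneg_right ((min_le_right _ _).trans (hτt k)) (norm_nonneg _)⟩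
  have hm0 : 0 < min 1 τ := lt_min one_pos hτ0
  have hT0 : 0 < max 1 tbar := lt_max_of_lt_left one_pos
  have hdk : ∀ k, ‖d k‖ ≤ (min 1 τ)⁻¹ * ‖x (k + 1) - x k‖ := fun k => by
    rw [inv_mul_eq_div, le_div_iff₀ hm0, mul_comm]
    exact (hstep k).2
  have hyR : ∀ k, y k ∈ Metric.closedBall (0 : Vec n) (R + (min 1 τ)⁻¹ * (R + R)) := by
    intro k
    have h1 := hxR k
    have h2 := hxR (k + 1)
    rw [mem_closedBall_zero_iff] at h1 h2 ⊢
    rw [← hxd]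
    refine (norm_add_le _ _).trans (add_le_add h1 ((hdk k).trans ?_))
    exact mul_le_mul_of_nonneg_left ((norm_sub_le _ _).trans (add_le_add h2 h1)) (inv_pos.2 hm0).le
  have hR0 : 0 ≤ R := (norm_nonneg _).trans (mem_closedBall_zero_iff.1 (hxR 0))
  have hRR : R ≤ R + (min 1 τ)⁻¹ * (R + R) := by
    have : 0 ≤ (min 1 τ)⁻¹ * (R + R) := by positivity
    linarith
  obtain ⟨L', hL'⟩ := hLip.lipschitz _
    (isCompact_closedBall (0 : Vec n) (R + (min 1 τ)⁻¹ * (R + R)))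
  have hM : 0 ≤ M := (norm_nonneg _).trans (hhess 0)
  refine ⟨η, c₁ * τ * (σ / (2 * lam)) / max 1 tbar ^ 2, (L' + lam⁻¹ * M + 1) * (min 1 τ)⁻¹,
    (min 1 τ)⁻¹, by positivity, by positivity, hxC, hyC,
    Metric.isBounded_closedBall.subset (range_subset_iff.2 hxR), fun k h => ?_, fun k => ?_,
    fun k => (hupd k).2.2, fun k => ?_, fun k => ?_, hsub, fun k => ?_⟩
  · have := (hstep k).2
    rw [h, sub_self, norm_zero] at this
    exact absurd this (not_le.2 (mul_pos hm0 (hd0 k)))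
  · have h1 : ‖x (k + 1) - x k‖ ^ 2 ≤ max 1 tbar ^ 2 * ‖d k‖ ^ 2 := by
      rw [← mul_pow]
      exact pow_le_pow_left₀ (norm_nonneg _) (hstep k).1 2
    have h2 : c₁ * τ * (σ / (2 * lam)) / max 1 tbar ^ 2 * ‖x (k + 1) - x k‖ ^ 2 ≤
        c₁ * τ * (σ / (2 * lam)) * ‖d k‖ ^ 2 := by
      rw [div_mul_eq_mul_div, div_le_iff₀ (by positivity)]
      calc _ ≤ c₁ * τ * (σ / (2 * lam)) * (max 1 tbar ^ 2 * ‖d k‖ ^ 2) :=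
            mul_le_mul_of_nonneg_left h1 (by positivity)
        _ = _ := by ring
    have h3 : c₁ * τ * (σ / (2 * lam)) * ‖d k‖ ^ 2 ≤ c₁ * t k * (σ / (2 * lam) * ‖d k‖ ^ 2) := by
      calc _ = τ * (c₁ * (σ / (2 * lam) * ‖d k‖ ^ 2)) := by ring
        _ ≤ t k * (c₁ * (σ / (2 * lam) * ‖d k‖ ^ 2)) :=
            mul_le_mul_of_nonneg_right (hτt k) (by positivity)
        _ = _ := by ring
    linarith [(harm k).2, (hupd k).2.1]
  · rw [← hgen.direction k]
    linarith [hdesc k, hHq k]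
  · rw [← hgen.direction k]
    exact hdk k
  · have h1 := hL'.dist_le_mul _ (hyR k) _ (Metric.closedBall_subset_closedBall hRR (hxR k))
    rw [dist_eq_norm, dist_eq_norm, ← hgen.direction k] at h1
    have h2 : ‖lam⁻¹ • hess φ (x k) (d k)‖ ≤ lam⁻¹ * (M * ‖d k‖) := by
      rw [norm_smul, Real.norm_of_nonneg (inv_pos.2 hlam).le]
      refine mul_le_mul_of_nonneg_left ?_ (inv_pos.2 hlam).le
      exact (ContinuousLinearMap.le_opNorm _ _).trans
        (mul_le_mul_of_nonneg_right (hhess k) (norm_nonneg _))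
    have h3 : grad f (y k) + η k =
        (grad f (y k) - grad f (x k)) - lam⁻¹ • hess φ (x k) (d k) := by
      simp only [hη]; abel
    rw [h3]
    calc _ ≤ L' * ‖d k‖ + lam⁻¹ * (M * ‖d k‖) := (norm_sub_le _ _).trans (add_le_add h1 h2)
      _ ≤ (L' + lam⁻¹ * M + 1) * ‖d k‖ := by linarith [norm_nonneg (d k)]
      _ ≤ (L' + lam⁻¹ * M + 1) * ((min 1 τ)⁻¹ * ‖x (k + 1) - x k‖) :=
          mul_le_mul_of_nonneg_left (hdk k) (by positivity)
      _ = _ := by ring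

variable {C : Set (Vec n)} {f g : Vec n → EReal} {x y η : ℕ → Vec n} {ρ₁ ρ₂ κ : ℝ}

/-! ### Limits along a run -/

namespace IsDescentRun

lemma objective_x (h : IsDescentRun C f g x y η ρ₁ ρ₂ κ) (hf : GradLipschitzOnCompacts f)
    (hg : ∀ z, g z ≠ ⊥) (hgC : C ⊆ dom g) (k : ℕ) :
    objective f g (x k) = (realObjective f g (x k) : EReal) :=
  objective_eq_coe hf (hg _) (hgC (h.x_mem k)).ne

lemma objective_y (h : IsDescentRun C f g x y η ρ₁ ρ₂ κ) (hf : GradLipschitzOnCompacts f)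
    (hg : ∀ z, g z ≠ ⊥) (hgC : C ⊆ dom g) (k : ℕ) :
    objective f g (y k) = (realObjective f g (y k) : EReal) :=
  objective_eq_coe hf (hg _) (hgC (h.y_mem k)).ne

lemma strictAnti (h : IsDescentRun C f g x y η ρ₁ ρ₂ κ) (hρ₁ : 0 < ρ₁) :
    StrictAnti fun k => realObjective f g (x k) := by
  refine strictAnti_nat_of_succ_lt fun k => ?_
  have h1 : 0 < ‖x (k + 1) - x k‖ := norm_pos_iff.2 (sub_ne_zero.2 (h.step_ne k))
  have h2 : 0 < ρ₁ * ‖x (k + 1) - x k‖ ^ 2 := by positivity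
  linarith [h.decrease k]

lemma exists_tendsto_objective (h : IsDescentRun C f g x y η ρ₁ ρ₂ κ)
    (hf : GradLipschitzOnCompacts f) (hg : ∀ z, g z ≠ ⊥) (hgC : C ⊆ dom g) (hρ₁ : 0 < ρ₁)
    (hbdd : ⊥ < ⨅ z ∈ closure C, objective f g z) :
    ∃ ζ, Tendsto (fun k => realObjective f g (x k)) atTop (𝓝 ζ) := by
  obtain ⟨m, -, hm⟩ := EReal.lt_iff_exists_real_btwn.1 hbdd
  refine ⟨_, tendsto_atTop_ciInf (h.strictAnti hρ₁).antitone ⟨m, ?_⟩⟩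
  rintro _ ⟨k, rfl⟩
  have := hm.le.trans (iInf₂_le (x k) (subset_closure (h.x_mem k)))
  rwa [h.objective_x hf hg hgC, EReal.coe_le_coe_iff] at this

lemma tendsto_norm_step (h : IsDescentRun C f g x y η ρ₁ ρ₂ κ) (hρ₁ : 0 < ρ₁) {ζ : ℝ}
    (hζ : Tendsto (fun k => realObjective f g (x k)) atTop (𝓝 ζ)) :
    Tendsto (fun k => ‖x (k + 1) - x k‖) atTop (𝓝 0) := by
  have h1 : Tendsto (fun k => (realObjective f g (x k) - realObjective f g (x (k + 1))) / ρ₁) atTop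
      (𝓝 0) := by
    simpa using (hζ.sub (hζ.comp (tendsto_add_atTop_nat 1))).div_const ρ₁
  have h2 : Tendsto (fun k => ‖x (k + 1) - x k‖ ^ 2) atTop (𝓝 0) := by
    refine squeeze_zero (fun k => by positivity) (fun k => ?_) h1
    rw [le_div_iff₀ hρ₁]
    linarith [h.decrease k]
  simpa using h2.sqrt

lemma tendsto_norm_trial_sub (h : IsDescentRun C f g x y η ρ₁ ρ₂ κ)
    (hδ : Tendsto (fun k => ‖x (k + 1) - x k‖) atTop (𝓝 0)) :
    Tendsto (fun k => y k - x k) atTop (𝓝 0) :=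
  squeeze_zero_norm h.norm_trial_sub_le (by simpa using hδ.const_mul κ)

/-- The objective has the same limit at the trial points: it lies above `Ψ(x^{k+1})`, and exceeds
`Ψ(x^k)` at most by the linearization error of `f`. -/
lemma tendsto_objective_trial (h : IsDescentRun C f g x y η ρ₁ ρ₂ κ)
    (hf : GradLipschitzOnCompacts f) {ζ : ℝ}
    (hζ : Tendsto (fun k => realObjective f g (x k)) atTop (𝓝 ζ))
    (hyx : Tendsto (fun k => y k - x k) atTop (𝓝 0)) :
    Tendsto (fun k => realObjective f g (y k)) atTop (𝓝 ζ) := by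
  obtain ⟨R, hR⟩ := h.bounded.subset_closedBall 0
  have hxR : ∀ k, x k ∈ Metric.closedBall (0 : Vec n) R := fun k => hR (mem_range_self k)
  have hcont := hf.differentiable.continuous
  have hK := isCompact_closedBall (0 : Vec n) (R + 1)
  -- on a compact neighbourhood of the iterates `f` is uniformly continuous and `∇f` is bounded
  have hyR : ∀ᶠ k in atTop, y k ∈ Metric.closedBall (0 : Vec n) (R + 1) := by
    filter_upwards [hyx.norm.eventually_le_const (by simp : ‖(0 : Vec n)‖ < 1)] with k hk
    have h1 := hxR k
    rw [mem_closedBall_zero_iff] at h1 ⊢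
    calc ‖y k‖ = ‖x k + (y k - x k)‖ := by rw [add_sub_cancel]
      _ ≤ R + 1 := (norm_add_le _ _).trans (add_le_add h1 hk)
  have hunif := hK.uniformContinuousOn_of_continuous hcont.continuousOn
  have hfd : Tendsto (fun k => realPart f (y k) - realPart f (x k)) atTop (𝓝 0) := by
    rw [Metric.tendsto_nhds]
    intro ε hε
    obtain ⟨δ, hδ, hu⟩ := Metric.uniformContinuousOn_iff.1 hunif ε hε
    filter_upwards [hyR, hyx.norm.eventually_lt_const (by simpa using hδ)] with k hk1 hk2
    have := hu (y k) hk1 (x k) (Metric.closedBall_subset_closedBall (by linarith) (hxR k))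
      (by rwa [dist_eq_norm])
    simpa [Real.dist_eq] using this
  obtain ⟨G, hG⟩ := hK.exists_bound_of_continuousOn hf.continuous_grad.continuousOn
  have hin : Tendsto (fun k => inner ℝ (grad f (x k)) (y k - x k)) atTop (𝓝 0) := by
    refine squeeze_zero_norm (a := fun k => G * ‖y k - x k‖) (fun k => ?_)
      (by simpa using hyx.norm.const_mul G)
    refine (norm_inner_le_norm _ _).trans (mul_le_mul_of_nonneg_right ?_ (norm_nonneg _))
    exact hG _ (Metric.closedBall_subset_closedBall (by linarith) (hxR k))
  refine tendsto_of_tendsto_of_tendsto_of_le_of_le (hζ.comp (tendsto_add_atTop_nat 1))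
    (h := fun k => realObjective f g (x k) + ((realPart f (y k) - realPart f (x k)) -
      inner ℝ (grad f (x k)) (y k - x k)))
    (by simpa using hζ.add (hfd.sub hin)) (fun k => h.le_trial k) fun k => ?_
  have := h.trial_descent k
  simp only [realObjective]
  linarith

/-- The residual `∇f(y k) + η k` is a regular subgradient of the objective, since `y k` lies in the
open set `C`, where the indicator of `cl C` vanishes. -/
lemma residual_mem_regularSubdiff (h : IsDescentRun C f g x y η ρ₁ ρ₂ κ)
    (hf : GradLipschitzOnCompacts f) (hg : ∀ z, g z ≠ ⊥) (hgC : C ⊆ dom g) (hC : IsOpen C)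
    (k : ℕ) : grad f (y k) + η k ∈ regularSubdiff (objective f g) (y k) := by
  refine grad_add_mem_regularSubdiff_objective hf.finite (hf.differentiable _)
    (coe_realPart (hg _) (hgC (h.y_mem k)).ne) ?_
  filter_upwards [hC.mem_nhds (h.y_mem k)] with z hz using h.subgradient k z (subset_closure hz)

lemma subgradient_add_indicator (h : IsDescentRun C f g x y η ρ₁ ρ₂ κ)
    (hg : ∀ z, g z ≠ ⊥) (hgC : C ⊆ dom g) (k : ℕ) :
    η k ∈ limitingSubdiff (fun u => g u + indicatorFn (closure C) u) (y k) := by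
  refine mem_limitingSubdiff_of_le (a := realPart g (y k)) ?_ fun z => ?_
  · rw [indicatorFn, if_pos (subset_closure (h.y_mem k)), add_zero]
    exact coe_realPart (hg _) (hgC (h.y_mem k)).ne
  · by_cases hz : z ∈ closure C
    · simpa [indicatorFn, hz] using h.subgradient k z hz
    · simp [indicatorFn, hz, EReal.add_top_of_ne_bot (hg z)]

/-- At a cluster point the objective equals the limit of the objective values, the point is
stationary, and `0` is a limiting subgradient of the objective. Lower semicontinuity of `g` bounds
`g` at the cluster point from above, and the subgradient inequality at the trial points bounds it
from below. -/
lemma of_mapClusterPt (h : IsDescentRun C f g x y η ρ₁ ρ₂ κ)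
    (hf : GradLipschitzOnCompacts f) (hg : ∀ z, g z ≠ ⊥) (hgC : C ⊆ dom g) (hC : IsOpen C)
    (hlsc : LowerSemicontinuous g) {ζ : ℝ}
    (hδ : Tendsto (fun k => ‖x (k + 1) - x k‖) atTop (𝓝 0))
    (hyx : Tendsto (fun k => y k - x k) atTop (𝓝 0))
    (hζ : Tendsto (fun k => realObjective f g (y k)) atTop (𝓝 ζ))
    {xbar : Vec n} (hcl : MapClusterPt xbar atTop x) :
    objective f g xbar = ζ ∧ IsStationary C f g xbar ∧
      0 ∈ limitingSubdiff (objective f g) xbar := by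
  obtain ⟨θ, hθ, hxθ⟩ := hcl.tendsto_subseq
  have hθ' := hθ.tendsto_atTop
  have hyθ : Tendsto (y ∘ θ) atTop (𝓝 xbar) := by
    simpa [Function.comp_def] using hxθ.add (hyx.comp hθ')
  have hw : Tendsto (fun k => grad f (y k) + η k) atTop (𝓝 0) :=
    squeeze_zero_norm h.residual (by simpa using hδ.const_mul ρ₂)
  have hgrad : Tendsto (fun j => grad f (y (θ j))) atTop (𝓝 (grad f xbar)) :=
    (hf.continuous_grad.tendsto xbar).comp hyθ
  have hηθ : Tendsto (fun j => η (θ j)) atTop (𝓝 (-grad f xbar)) := by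
    simpa [Function.comp_def] using (hw.comp hθ').sub hgrad
  set b := ζ - realPart f xbar with hb
  have hgθ : Tendsto (fun j => realPart g (y (θ j))) atTop (𝓝 b) := by
    have h1 := (hf.differentiable.continuous.tendsto xbar).comp hyθ
    simpa [Function.comp_def, realObjective] using (hζ.comp hθ').sub h1
  have hsub : ∀ z ∈ closure C,
      ((b + inner ℝ (-grad f xbar) (z - xbar) : ℝ) : EReal) ≤ g z := by
    intro z hz
    have hlim := (continuous_coe_real_ereal.tendsto _).comp
      (hgθ.add (hηθ.inner (𝕜 := ℝ) (tendsto_const_nhds (x := z).sub hyθ)))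
    exact le_of_tendsto' hlim fun j => h.subgradient (θ j) z hz
  have hxc : xbar ∈ closure C :=
    mem_closure_of_tendsto hxθ (Eventually.of_forall fun j => h.x_mem _)
  have hgx : g xbar = b := by
    refine le_antisymm (le_of_forall_lt fun c hc => ?_) (by simpa using hsub xbar hxc)
    obtain ⟨c', hcc', hc'⟩ := exists_between hc
    refine hcc'.trans_le (ge_of_tendsto ((continuous_coe_real_ereal.tendsto _).comp hgθ) ?_)
    filter_upwards [hyθ.eventually (hlsc xbar c' hc')] with j hj
    have := coe_realPart (hg _) (hgC (h.y_mem (θ j))).ne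
    simp only [Function.comp_apply] at hj ⊢
    rw [← this]
    exact hj.le
  have hobj : objective f g xbar = ζ := by
    rw [objective, hgx, coe_realPart (hf.finite xbar).1 (hf.finite xbar).2, ← EReal.coe_add, hb]
    simp
  refine ⟨hobj, ⟨-grad f xbar, ?_, by simp⟩, ?_⟩
  · refine mem_limitingSubdiff_of_le (a := b) (by simp [indicatorFn, hxc, hgx]) fun z => ?_
    by_cases hz : z ∈ closure C
    · simpa [indicatorFn, hz] using hsub z hz
    · simp [indicatorFn, hz, EReal.add_top_of_ne_bot (hg z)]
  · refine ⟨by simp [dom, hobj], y ∘ θ, fun j => grad f (y (θ j)) + η (θ j), hyθ, ?_,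
      hw.comp hθ', fun j => h.residual_mem_regularSubdiff hf hg hgC hC _⟩
    rw [hobj]
    refine ((continuous_coe_real_ereal.tendsto _).comp (hζ.comp hθ')).congr fun j => ?_
    exact (h.objective_y hf hg hgC _).symm

/-- The one-step inequality at late iterates near a cluster point. -/
lemma exists_two_mul_norm_step_le (h : IsDescentRun C f g x y η ρ₁ ρ₂ κ)
    (hf : GradLipschitzOnCompacts f) (hg : ∀ z, g z ≠ ⊥) (hgC : C ⊆ dom g) (hC : IsOpen C)
    (hρ₁ : 0 < ρ₁) (hρ₂ : 0 < ρ₂) {ζ : ℝ}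
    (hζx : Tendsto (fun k => realObjective f g (x k)) atTop (𝓝 ζ))
    (hζy : Tendsto (fun k => realObjective f g (y k)) atTop (𝓝 ζ))
    {xbar : Vec n} (hxbar : objective f g xbar = ζ) {U : Set (Vec n)} {v : EReal} {ψ : ℝ → ℝ}
    (hKL : KLInequalityOn (objective f g) xbar U v ψ) :
    ∃ K : ℕ, ∀ m ≥ K, y m ∈ U → 2 * ‖x (m + 1 + 1) - x (m + 1)‖ ≤ ‖x (m + 1) - x m‖ +
      chi (objective f g) ψ ρ₁ ρ₂ xbar x (m + 1) := by
  obtain ⟨hv, hψ, hineq⟩ := hKL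
  have hlim : Tendsto (fun k => ((realObjective f g (y k) - ζ : ℝ) : EReal)) atTop (𝓝 0) := by
    have := (continuous_coe_real_ereal.tendsto _).comp (hζy.sub_const ζ)
    simpa [Function.comp_def] using this
  obtain ⟨K, hK⟩ := eventually_atTop.1 (hlim.eventually_lt_const hv)
  refine ⟨K, fun m hm hym => ?_⟩
  have hgap : ∀ k, ζ < realObjective f g (x k) := fun k =>
    ((h.strictAnti hρ₁).antitone.le_of_tendsto hζx (k + 1)).trans_lt
      (h.strictAnti hρ₁ (Nat.lt_succ_self k))
  have hylt : ζ < realObjective f g (y m) := (hgap (m + 1)).trans_le (h.le_trial m)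
  have hy := hineq (y m) hym
  rw [hxbar, h.objective_y hf hg hgC, ← EReal.coe_sub, EReal.toReal_coe] at hy
  have hlt : (realObjective f g (y m) : EReal) < ζ + v := by
    have := EReal.add_lt_add_left_coe (hK m hm) ζ
    rwa [← EReal.coe_add, add_sub_cancel] at this
  have hdist := hy (EReal.coe_lt_coe_iff.2 hylt) hlt
  set q := realObjective f g (y m) - ζ with hq
  have hw : Metric.infEDist (0 : Vec n) (limitingSubdiff (objective f g) (y m)) ≤
      ENNReal.ofReal (ρ₂ * ‖x (m + 1) - x m‖) := by
    refine (Metric.infEDist_le_edist_of_mem (regularSubdiff_subset_limitingSubdiff _ _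
      (h.residual_mem_regularSubdiff hf hg hgC hC m))).trans ?_
    rw [edist_dist, dist_zero_left]
    exact ENNReal.ofReal_le_ofReal (h.residual m)
  have hdist' : 1 ≤ deriv ψ q * (ρ₂ * ‖x (m + 1) - x m‖) := by
    have h1 := hdist.trans (mul_le_mul_right hw _)
    rwa [← ENNReal.ofReal_mul (hψ.deriv_pos q (sub_pos.2 hylt) (hK m hm)).le,
      ENNReal.one_le_ofReal] at h1
  rw [chi, hxbar, h.objective_x hf hg hgC, h.objective_x hf hg hgC, ← EReal.coe_sub,
    ← EReal.coe_sub, EReal.toReal_coe, EReal.toReal_coe]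
  refine hψ.two_mul_le (sub_nonneg.2 (hgap _).le) ?_ (sub_pos.2 (hgap _)) (hK m hm) hρ₁ hρ₂
    (norm_nonneg _) (norm_nonneg _) ?_ hdist'
  · linarith [h.le_trial m]
  · linarith [h.decrease (m + 1)]

end IsDescentRun

/-- The one-step inequality, the trapping of the iterates in the ball with the summed inequality,
and finite length, all near a cluster point at which the KL inequality holds. -/
lemma IsDescentRun.of_KLInequalityOn (h : IsDescentRun C f g x y η ρ₁ ρ₂ κ)
    (hf : GradLipschitzOnCompacts f) (hg : ∀ z, g z ≠ ⊥) (hgC : C ⊆ dom g) (hC : IsOpen C)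
    (hρ₁ : 0 < ρ₁) (hρ₂ : 0 < ρ₂) {ζ : ℝ}
    (hζx : Tendsto (fun k => realObjective f g (x k)) atTop (𝓝 ζ))
    {xbar : Vec n} (hxbar : objective f g xbar = ζ) (hcl : MapClusterPt xbar atTop x)
    {ρ : ℝ} (hρ : 0 < ρ) {v : EReal} {ψ : ℝ → ℝ}
    (hKL : KLInequalityOn (objective f g) xbar (Metric.closedBall xbar ρ) v ψ) :
    (∃ K : ℕ, ∀ k₀ ≥ K, ∀ k ≥ 1, x (k₀ + k) ∈ Metric.closedBall xbar ρ →
      y (k₀ + k - 1) ∈ Metric.closedBall xbar ρ →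
      2 * ‖x (k₀ + k + 1) - x (k₀ + k)‖ ≤ ‖x (k₀ + k) - x (k₀ + k - 1)‖ +
        chi (objective f g) ψ ρ₁ ρ₂ xbar x (k₀ + k)) ∧
    (∃ k₀ : ℕ, ∀ k ≥ 1, x (k₀ + k) ∈ Metric.closedBall xbar ρ ∧
      y (k₀ + k - 1) ∈ Metric.closedBall xbar ρ ∧
      (∑ i ∈ Finset.Icc (k₀ + 1) (k₀ + k), ‖x (i + 1) - x i‖) + ‖x (k₀ + k + 1) - x (k₀ + k)‖ ≤
        ‖x (k₀ + 1) - x k₀‖ + ∑ i ∈ Finset.Icc (k₀ + 1) (k₀ + k),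
          chi (objective f g) ψ ρ₁ ρ₂ xbar x i) ∧
    Summable fun k => ‖x (k + 1) - x k‖ := by
  have hδ := h.tendsto_norm_step hρ₁ hζx
  have hyx := h.tendsto_norm_trial_sub hδ
  have hζy := h.tendsto_objective_trial hf hζx hyx
  have hstep : ∃ K : ℕ, ∀ k₀ ≥ K, ∀ k ≥ 1, x (k₀ + k) ∈ Metric.closedBall xbar ρ →
      y (k₀ + k - 1) ∈ Metric.closedBall xbar ρ →
      2 * ‖x (k₀ + k + 1) - x (k₀ + k)‖ ≤ ‖x (k₀ + k) - x (k₀ + k - 1)‖ +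
        chi (objective f g) ψ ρ₁ ρ₂ xbar x (k₀ + k) := by
    obtain ⟨K, hK⟩ := h.exists_two_mul_norm_step_le hf hg hgC hC hρ₁ hρ₂ hζx hζy hxbar hKL
    refine ⟨K, fun k₀ hk₀ k hk _ hy => ?_⟩
    obtain ⟨j, rfl⟩ := Nat.exists_eq_add_of_le' hk
    exact hK (k₀ + j) (by omega) hy
  obtain ⟨hv, hψ, -⟩ := hKL
  set S : ℕ → ℝ := fun k => ρ₂ / ρ₁ * ψ (realObjective f g (x k) - ζ) with hSdef
  have hchi : ∀ k, chi (objective f g) ψ ρ₁ ρ₂ xbar x k = S k - S (k + 1) := fun k => by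
    rw [chi, hxbar, h.objective_x hf hg hgC, h.objective_x hf hg hgC, ← EReal.coe_sub,
      ← EReal.coe_sub, EReal.toReal_coe, EReal.toReal_coe, mul_sub]
  have hr0 : ∀ k, 0 ≤ realObjective f g (x k) - ζ := fun k =>
    sub_nonneg.2 ((h.strictAnti hρ₁).antitone.le_of_tendsto hζx k)
  have hr : Tendsto (fun k => realObjective f g (x k) - ζ) atTop (𝓝 0) := by
    simpa using hζx.sub_const ζ
  have hrv : ∀ᶠ k in atTop, ((realObjective f g (x k) - ζ : ℝ) : EReal) < v :=
    ((continuous_coe_real_ereal.tendsto 0).comp hr).eventually_lt_const hv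
  have hS : Tendsto S atTop (𝓝 0) := by
    simpa using (hψ.tendsto_zero hr0 hr hrv).const_mul (ρ₂ / ρ₁)
  have hS0 : ∀ᶠ k in atTop, 0 ≤ S k := by
    filter_upwards [hrv] with k hk
    exact mul_nonneg (div_pos hρ₂ hρ₁).le (hψ.nonneg _ (hr0 k) hk)
  refine ⟨hstep, ?_⟩
  simp only [hchi] at hstep ⊢
  obtain ⟨k₀, hk₀⟩ := exists_stays_in_closedBall hρ hcl hδ
    (by simpa [dist_eq_norm] using hyx.norm) hS hS0 hstep
  exact ⟨⟨k₀, fun k hk => ⟨((hk₀ k).1 hk).1, ((hk₀ k).1 hk).2, (hk₀ k).2.1⟩⟩,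
    summable_of_sum_Icc_le (fun _ => norm_nonneg _) fun k => (hk₀ k).2.2⟩

end ABPG

/-! ### Global convergence -/

theorem mainTheorem2 {n : ℕ} (C : Set (ABPG.Vec n)) (f g φ : ABPG.Vec n → EReal)
    (hbasic : ABPG.BasicAssumptions C f g φ)
    (hfeas : ABPG.Feasible C f g φ)
    (hstrong : ∃ σ : ℝ, 0 < σ ∧ StrongConvexOn C σ (ABPG.realPart φ))
    (hlevel : ABPG.LevelBounded (ABPG.objective f g))
    (hLip : ABPG.GradLipschitzOnCompacts f)
    (hKL : ABPG.IsKLFunction (ABPG.objective f g))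
    (lam c₁ c₂ : ℝ) (hlam : 0 < lam) (hc₁ : 0 < c₁) (hc : c₁ < c₂) (hc₂ : c₂ < 1)
    (x y d ξ : ℕ → ABPG.Vec n) (t : ℕ → ℝ)
    (hgen : ABPG.IsGenerated C f g φ lam c₁ c₂ x y d ξ t)
    (ht : ∃ tbar : ℝ, ∀ k, t k < tbar)
    (hhess : ∃ M : ℝ, ∀ k, ‖ABPG.hess φ (x k)‖ ≤ M) :
    -- constants `ρ₁`, `ρ₂` of sufficient decrease and of the subgradient bound
    (∃ ρ₁ ρ₂ : ℝ, 0 < ρ₁ ∧ 0 < ρ₂ ∧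
      (∀ k, ABPG.objective f g (x (k + 1)) + ((ρ₁ * ‖x (k + 1) - x k‖ ^ 2 : ℝ) : EReal)
        ≤ ABPG.objective f g (x k)) ∧
      (∀ k, ∃ η ∈ ABPG.limitingSubdiff
          (fun u => g u + ABPG.indicatorFn (closure C) u) (y k),
        ‖ABPG.grad f (y k) + η‖ ≤ ρ₂ * ‖x (k + 1) - x k‖) ∧
      ∀ xbar : ABPG.Vec n, MapClusterPt xbar Filter.atTop x →
        (∃ (ρ : ℝ) (v : EReal) (ψ : ℝ → ℝ), 0 < ρ ∧
          ABPG.KLInequalityOn (ABPG.objective f g) xbar (Metric.closedBall xbar ρ) v ψ) ∧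
        ∀ (ρ : ℝ) (v : EReal) (ψ : ℝ → ℝ), 0 < ρ →
          ABPG.KLInequalityOn (ABPG.objective f g) xbar (Metric.closedBall xbar ρ) v ψ →
          -- (i) the one-step inequality
          (∃ K : ℕ, ∀ k₀ ≥ K, ∀ k ≥ 1,
            x (k₀ + k) ∈ Metric.closedBall xbar ρ →
            y (k₀ + k - 1) ∈ Metric.closedBall xbar ρ →
            2 * ‖x (k₀ + k + 1) - x (k₀ + k)‖ ≤
              ‖x (k₀ + k) - x (k₀ + k - 1)‖ +
                ABPG.chi (ABPG.objective f g) ψ ρ₁ ρ₂ xbar x (k₀ + k)) ∧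
          -- (ii) the iterates stay in the ball, with the summed inequality
          (∃ k₀ : ℕ, ∀ k ≥ 1,
            x (k₀ + k) ∈ Metric.closedBall xbar ρ ∧
            y (k₀ + k - 1) ∈ Metric.closedBall xbar ρ ∧
            (∑ i ∈ Finset.Icc (k₀ + 1) (k₀ + k), ‖x (i + 1) - x i‖) +
                ‖x (k₀ + k + 1) - x (k₀ + k)‖ ≤
              ‖x (k₀ + 1) - x k₀‖ +
                ∑ i ∈ Finset.Icc (k₀ + 1) (k₀ + k),
                  ABPG.chi (ABPG.objective f g) ψ ρ₁ ρ₂ xbar x i)) ∧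
    -- (iii) convergence to a stationary point and finite length
    (∃ xstar : ABPG.Vec n, Filter.Tendsto x Filter.atTop (nhds xstar) ∧
      ABPG.IsStationary C f g xstar) ∧
    Summable (fun k => ‖x (k + 1) - x k‖) := by
  obtain ⟨σ, hσ, hstrong⟩ := hstrong
  obtain ⟨tbar, ht⟩ := ht
  obtain ⟨M, hM⟩ := hhess
  obtain ⟨η, ρ₁, ρ₂, κ, hρ₁, hρ₂, h⟩ := hgen.exists_isDescentRun hbasic hfeas hσ hstrong hlevel hLip
    hlam hc₁ hc₂ ht hM
  have hg := hbasic.g_proper.1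
  have hgC := hbasic.g_dom
  have hC := hbasic.C_open
  obtain ⟨ζ, hζ⟩ := h.exists_tendsto_objective hLip hg hgC hρ₁ hbasic.bounded_below
  have hδ := h.tendsto_norm_step hρ₁ hζ
  have hyx := h.tendsto_norm_trial_sub hδ
  have hcluster : ∀ {xbar}, MapClusterPt xbar Filter.atTop x → _ := fun hcl =>
    h.of_mapClusterPt hLip hg hgC hC hbasic.g_lsc hδ hyx (h.tendsto_objective_trial hLip hζ hyx) hcl
  have hball : ∀ xbar, MapClusterPt xbar Filter.atTop x →
      ∃ (ρ : ℝ) (v : EReal) (ψ : ℝ → ℝ), 0 < ρ ∧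
        ABPG.KLInequalityOn (ABPG.objective f g) xbar (Metric.closedBall xbar ρ) v ψ := by
    intro xbar hcl
    obtain ⟨v, U, ψ, hU, hv, hψ, hKL⟩ := hKL xbar ⟨0, (hcluster hcl).2.2⟩
    obtain ⟨ρ, hρ, hρU⟩ := Metric.nhds_basis_closedBall.mem_iff.1 hU
    exact ⟨ρ, v, ψ, hρ, hv, hψ, fun z hz => hKL z (hρU hz)⟩
  refine ⟨⟨ρ₁, ρ₂, hρ₁, hρ₂, fun k => ?_, fun k => ?_, fun xbar hcl => ⟨hball xbar hcl, ?_⟩⟩, ?_⟩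
  · rw [h.objective_x hLip hg hgC, h.objective_x hLip hg hgC, ← EReal.coe_add,
      EReal.coe_le_coe_iff]
    exact h.decrease k
  · exact ⟨η k, h.subgradient_add_indicator hg hgC k, h.residual k⟩
  · intro ρ v ψ hρ hKL
    obtain ⟨h1, h2, -⟩ :=
      h.of_KLInequalityOn hLip hg hgC hC hρ₁ hρ₂ hζ (hcluster hcl).1 hcl hρ hKL
    exact ⟨h1, h2⟩
  · obtain ⟨xstar, -, θ, hθ, hxθ⟩ := tendsto_subseq_of_bounded h.bounded fun k => mem_range_self k
    have hcl : MapClusterPt xstar Filter.atTop x := hxθ.mapClusterPt.of_comp hθ.tendsto_atTop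
    obtain ⟨ρ, v, ψ, hρ, hKL⟩ := hball xstar hcl
    have hsum := (h.of_KLInequalityOn hLip hg hgC hC hρ₁ hρ₂ hζ (hcluster hcl).1 hcl hρ hKL).2.2
    exact ⟨⟨xstar, ABPG.tendsto_of_summable_of_mapClusterPt hsum hcl, (hcluster hcl).2.1⟩, hsum⟩
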